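/- Write $\langle t\rangle=(1+|t|^2)^{1/2}$ for $t\in\mathbb{R}$ and $\widehat f(\xi)=(2\pi)^{-d}\int_{\mathbb{R}^d}f(x)e^{-i\xi\cdot x}\,dx$. For a function $\Phi\in C^\infty(\mathbb{R}^d\setminus\{0\},\mathbb{R})$ that is homogeneous of degree $0$ (that is, $\Phi(r\xi)=\Phi(\xi)$ for all $r>0$, $\xi\neq0$) and $t\in\mathbb{R}$, let $T_\Phi^t$ be the Fourier multiplier operator defined on Schwartz functions $f\in\mathcal{S}(\mathbb{R}^d)$ by $$T_\Phi^t f(x)=\int_{\mathbb{R}^d}e^{it\Phi(\xi)+i\xi\cdot x}\,\widehat f(\xi)\,d\xi ,$$ and let $\|T_\Phi^t\|_{L^p\to L^p}=\sup_{0\neq f\in\mathcal{S}(\mathbb{R}^d)}\|T_\Phi^tf\|_{L^p}/\|f\|_{L^p}$. Let $1<p<\infty$. (a) Let $d=2$. For every nonconstant $\Phi\in C^\infty(\mathbb{R}^2\setminus\{0\},\mathbb{R})$ that is homogeneous of degree $0$ there is a constant $c=c_{p,\Phi}>0$ such that for all $t\in\mathbb{R}$ $$\|T_\Phi^t\|_{L^p\to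 L^p}\ \ge\ c\,\langle t\rangle^{2\left|\frac12-\frac1p\right|}.$$ (b) Let $d\ge3$. There is a set $\mathcal{G}\subseteq C^\infty(S^{d-1},\mathbb{R})$, independent of $p$, that is open and dense in the Whitney (strong $C^\infty$) topology, such that for every $\phi\in\mathcal{G}$ the $0$-homogeneous extension $\Phi(\xi)=\phi(\xi/|\xi|)$ belongs to $C^\infty(\mathbb{R}^d\setminus\{0\},\mathbb{R})$ and there is a constant $c=c_{d,p,\phi}>0$ such that for all $t\in\mathbb{R}$ $$\|T_\Phi^t\|_{L^p\to L^p}\ \ge\ c\,\langle t\rangle^{d\left|\frac12-\frac1p\right|}.$$ One may take for $\mathcal{G}$ the set of all Morse functions on $S^{d-1}$, that is, of the smooth functions all of whose critical points are nondegenerate (in a local chart the Hessian matrix at the critical point is invertible). -/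

import Mathlib

open scoped Manifold ContDiff ENNReal SchwartzMap Topology

noncomputable section

namespace GenericMultiplier

/-- Euclidean space `ℝ^d`. -/
abbrev Euc (d : ℕ) : Type := EuclideanSpace ℝ (Fin d)

/-- The unit sphere `S^n ⊆ ℝ^(n+1)`. -/
abbrev Sph (n : ℕ) : Type := Metric.sphere (0 : Euc (n + 1)) 1

/-- The Japanese bracket `⟨t⟩ = (1 + |t|^2)^(1/2)`. -/
def japanese (t : ℝ) : ℝ := Real.sqrt (1 + |t| ^ 2)

/-! ### The multiplier operators -/

/-- `Φ` is a smooth, `0`-homogeneous function on `ℝ^d ∖ {0}`. The value at `0` is irrelevant. -/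
structure IsSmoothZeroHomogeneous {d : ℕ} (Φ : Euc d → ℝ) : Prop where
  smooth : ContDiffOn ℝ ∞ Φ {0}ᶜ
  homogeneous : ∀ r : ℝ, 0 < r → ∀ ξ : Euc d, ξ ≠ 0 → Φ (r • ξ) = Φ ξ

/-- The Fourier transform normalized as `(2π)^(-d) ∫ f(x) e^{-i ξ·x} dx`. -/
def fourierHat {d : ℕ} (f : Euc d → ℂ) (ξ : Euc d) : ℂ :=
  (1 / (2 * (Real.pi : ℂ)) ^ d) *
    ∫ x : Euc d, f x * Complex.exp (-Complex.I * ((inner ℝ ξ x : ℝ) : ℂ))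

/-- `T_Φ^t f (x) = ∫ e^{i t Φ(ξ) + i ξ·x} f^(ξ) dξ` on Schwartz functions. -/
def multiplierOp {d : ℕ} (Φ : Euc d → ℝ) (t : ℝ) (f : 𝓢(Euc d, ℂ)) (x : Euc d) : ℂ :=
  ∫ ξ : Euc d,
    Complex.exp (Complex.I * ((t * Φ ξ : ℝ) : ℂ) + Complex.I * ((inner ℝ ξ x : ℝ) : ℂ)) *
      fourierHat f ξ

/-- The `L^p → L^p` norm of `T_Φ^t`: the supremum of `‖T_Φ^t f‖_p / ‖f‖_p` over the nonzero
Schwartz functions, as an extended nonnegative real. -/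
def multiplierNorm {d : ℕ} (Φ : Euc d → ℝ) (t : ℝ) (p : ℝ) : ℝ≥0∞ :=
  ⨆ (f : 𝓢(Euc d, ℂ)) (_ : f ≠ 0),
    MeasureTheory.eLpNorm (multiplierOp Φ t f) (ENNReal.ofReal p) MeasureTheory.volume /
      MeasureTheory.eLpNorm (fun x => f x) (ENNReal.ofReal p) MeasureTheory.volume

/-! ### Whitney topology and Morse functions -/

section Manifold

variable {n : ℕ} {M : Type} [TopologicalSpace M] [ChartedSpace (Euc n) M]

/-- The strong basic neighbourhood of order `r` of `f` in `C^∞(M, ℝ)`: given charts `ψ i`,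
sets `K i` in their domains and `ε i > 0`, the set of all `g` such that in the chart `ψ i`
all derivatives of orders `0, …, r` of `f` and `g` differ by less than `ε i` on `K i`. On the
target `ℝ` the identity chart is used. -/
def strongNhd (f : C^∞⟮𝓡 n, M; ℝ⟯) (r : ℕ) {ι : Type}
    (ψ : ι → OpenPartialHomeomorph M (Euc n)) (K : ι → Set M) (ε : ι → ℝ) :
    Set C^∞⟮𝓡 n, M; ℝ⟯ :=
  {g | ∀ i, ∀ x ∈ K i, ∀ k ≤ r,
    ‖iteratedFDeriv ℝ k (g ∘ (ψ i).symm) (ψ i x) -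
      iteratedFDeriv ℝ k (f ∘ (ψ i).symm) (ψ i x)‖ < ε i}

/-- The Whitney (strong) `C^∞` topology on `C^∞(M, ℝ)`: generated by the sets `strongNhd`, over
all finite orders, all families of smooth charts with locally finite domains, all compact subsets
of these domains, and all families of positive tolerances. -/
abbrev whitneyTopology (n : ℕ) (M : Type) [TopologicalSpace M] [ChartedSpace (Euc n) M] :
    TopologicalSpace C^∞⟮𝓡 n, M; ℝ⟯ :=
  TopologicalSpace.generateFrom
    {N | ∃ (f : C^∞⟮𝓡 n, M; ℝ⟯) (r : ℕ) (ι : Type)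
        (ψ : ι → OpenPartialHomeomorph M (Euc n)) (K : ι → Set M) (ε : ι → ℝ),
      (∀ i, ψ i ∈ IsManifold.maximalAtlas (𝓡 n) ∞ M) ∧
      LocallyFinite (fun i => (ψ i).source) ∧
      (∀ i, IsCompact (K i) ∧ K i ⊆ (ψ i).source) ∧
      (∀ i, 0 < ε i) ∧
      N = strongNhd f r ψ K ε}

/-- The Hessian matrix of `h : ℝ^n → ℝ` at `x`. -/
def hessian (h : Euc n → ℝ) (x : Euc n) : Matrix (Fin n) (Fin n) ℝ :=
  Matrix.of fun j k =>
    fderiv ℝ (fderiv ℝ h) x (EuclideanSpace.single j 1) (EuclideanSpace.single k 1)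

/-- `f` has a nondegenerate critical point at `p`: in some smooth chart at `p` the gradient
vanishes and the Hessian matrix is regular. -/
def HasNondegenerateCriticalPointAt (f : M → ℝ) (p : M) : Prop :=
  ∃ ψ ∈ IsManifold.maximalAtlas (𝓡 n) ∞ M, p ∈ ψ.source ∧
    fderiv ℝ (f ∘ ψ.symm) (ψ p) = 0 ∧ IsUnit (hessian (f ∘ ψ.symm) (ψ p))

/-- A smooth function is Morse if all its critical points are nondegenerate. -/
def IsMorse (f : C^∞⟮𝓡 n, M; ℝ⟯) : Prop :=
  ∀ p : M, mfderiv (𝓡 n) 𝓘(ℝ, ℝ) f p = 0 →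
    HasNondegenerateCriticalPointAt (n := n) f p

end Manifold

/-- The `0`-homogeneous extension `Φ(ξ) = φ(ξ / |ξ|)` of a function on the sphere (with the
irrelevant value `0` at the origin). -/
def homogeneousExtension {n : ℕ} (φ : Sph n → ℝ) (ξ : Euc (n + 1)) : ℝ :=
  open Classical in
  if h : ξ ≠ 0 then φ ⟨‖ξ‖⁻¹ • ξ, by simp [norm_smul, norm_ne_zero_iff.mpr h]⟩ else 0

end GenericMultiplier

end

/-
Suppose the second derivative of `Φ` is nondegenerate at some `ξ₀ ≠ 0`. A function `f` with `f^` a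
bump near `ξ₀` evolves to `u_t = T_Φ^t f` of constant `L²` norm with `|u_t| ≲ ⟨t⟩^(-d/2)`. By
interpolation `‖u_t‖_p ≳ ⟨t⟩^(d(1/p-1/2))` for `p ≤ 2`, tested on `u_0`, while for `p ≥ 2` one has
`‖u_(-t)‖_p ≲ ⟨t⟩^(-d(1/2-1/p))` and `T_Φ^t` takes `u_(-t)` to `u_0`. The decay is elementary:
`|u_t(x)|²` is bounded by the integral of the autocorrelation of the integrand, whose phase is the
difference `Φ(ξ + h) - Φ(ξ)` with gradient of size comparable to `|h|`.

By the Euler relations such a `ξ₀` is any point with `DΦ ≠ 0` when `d = 2`. For Morse `φ` it is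
found near a maximum, whose nondegeneracy on the tangent space becomes full nondegeneracy of `D²Φ`
at suitable nearby points. Morse functions are dense because, by the Sard theorem, `φ + ⟨a, ·⟩` is
Morse for almost every small `a`.
-/

noncomputable section

namespace GenericMultiplier

open MeasureTheory Set Filter
open scoped FourierTransform

section ParametricIntegral

variable {H F : Type*} [NormedAddCommGroup H] [NormedSpace ℝ H] [FiniteDimensional ℝ H]
  [NormedAddCommGroup F] [NormedSpace ℝ F]

theorem hasFDerivAt_intervalIntegral {f : H × ℝ → F} (hf : ContDiff ℝ 1 f) (a b : ℝ) (x₀ : H) :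
    HasFDerivAt (fun x => ∫ s in a..b, f (x, s))
      (∫ s in a..b, (fderiv ℝ f (x₀, s)).comp (ContinuousLinearMap.inl ℝ H ℝ)) x₀ := by
  have hcont : Continuous fun q : H × ℝ =>
      (fderiv ℝ f q).comp (ContinuousLinearMap.inl ℝ H ℝ) :=
    (hf.continuous_fderiv one_ne_zero).clm_comp continuous_const
  obtain ⟨C, hC⟩ := ((isCompact_closedBall x₀ 1).prod
    (isCompact_uIcc (a := a) (b := b))).exists_bound_of_continuousOn hcont.continuousOn
  have hfx : ∀ x, Continuous fun s => f (x, s) := fun x =>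
    hf.continuous.comp (Continuous.prodMk_right x)
  refine intervalIntegral.hasFDerivAt_integral_of_dominated_of_fderiv_le
    (F := fun x s => f (x, s)) (bound := fun _ => C) (Metric.closedBall_mem_nhds x₀ one_pos)
    (.of_forall fun x => (hfx x).aestronglyMeasurable) ((hfx x₀).intervalIntegrable _ _)
    (hcont.comp (Continuous.prodMk_right x₀)).aestronglyMeasurable
    (.of_forall fun s hs x hx => hC (x, s) ⟨hx, uIoc_subset_uIcc hs⟩)
    intervalIntegrable_const (.of_forall fun s _ x _ => ?_)
  exact ((hf.differentiable one_ne_zero (x, s)).hasFDerivAt).comp x (hasFDerivAt_prodMk_left x s)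

theorem contDiff_nat_intervalIntegral (n : ℕ) (a b : ℝ) {f : H × ℝ → F} (hf : ContDiff ℝ ∞ f) :
    ContDiff ℝ n (fun x => ∫ s in a..b, f (x, s)) := by
  have hder := hasFDerivAt_intervalIntegral (hf.of_le ENat.LEInfty.out) a b
  have hdiff : Differentiable ℝ fun x => ∫ s in a..b, f (x, s) :=
    fun x => (hder x).differentiableAt
  induction n generalizing f with
  | zero => exact contDiff_zero.2 hdiff.continuous
  | succ n ih =>
    push_cast
    refine contDiff_succ_iff_fderiv_apply.2 ⟨hdiff, by simp, fun y => ?_⟩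
    have hf' : ContDiff ℝ ∞ fun q => fderiv ℝ f q (y, 0) :=
      (hf.fderiv_right (m := ∞) (by simp)).clm_apply contDiff_const
    have hder' : (fun x => fderiv ℝ (fun x => ∫ s in a..b, f (x, s)) x y) =
        fun x => ∫ s in a..b, fderiv ℝ f (x, s) (y, 0) := by
      ext x
      have hinteg : Continuous fun s =>
          (fderiv ℝ f (x, s)).comp (ContinuousLinearMap.inl ℝ H ℝ) :=
        ((hf.continuous_fderiv (by simp)).comp (Continuous.prodMk_right x)).clm_comp
          continuous_const
      rw [(hder x).fderiv, ContinuousLinearMap.intervalIntegral_apply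
        (hinteg.intervalIntegrable a b)]
      rfl
    have hder₂ := hasFDerivAt_intervalIntegral (hf'.of_le ENat.LEInfty.out) a b
    rw [hder']
    exact ih hf' hder₂ fun x => (hder₂ x).differentiableAt

theorem contDiff_intervalIntegral (a b : ℝ) {f : H × ℝ → F} (hf : ContDiff ℝ ∞ f) :
    ContDiff ℝ ∞ (fun x => ∫ s in a..b, f (x, s)) :=
  contDiff_infty.2 fun n => contDiff_nat_intervalIntegral n a b hf

end ParametricIntegral

theorem exists_contDiff_forall_ge_mul_eq_one {m : ℝ} (hm : 0 < m) :
    ∃ G : ℝ → ℝ, ContDiff ℝ ∞ G ∧ ∀ x, m ≤ x → G x * x = 1 := by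
  refine ⟨fun x => Real.smoothTransition (2 / m * x - 1) * x⁻¹,
    contDiff_iff_contDiffAt.2 fun x => ?_, fun x hx => ?_⟩
  · rcases lt_or_ge x (m / 2) with hx | hx
    · have hzero : (fun x => Real.smoothTransition (2 / m * x - 1) * x⁻¹) =ᶠ[𝓝 x] fun _ => 0 := by
        filter_upwards [Iio_mem_nhds hx] with y hy
        have hle : 2 / m * y ≤ 1 := by
          rw [div_mul_eq_mul_div, div_le_one hm]
          linarith [mem_Iio.1 hy]
        rw [Real.smoothTransition.zero_of_nonpos (by linarith), zero_mul]
      exact contDiffAt_const.congr_of_eventuallyEq hzero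
    · exact (Real.smoothTransition.contDiff.contDiffAt.comp x (by fun_prop)).mul
        (contDiffAt_inv ℝ (by linarith : 0 < x).ne')
  · have hle : 2 ≤ 2 / m * x := by
      rw [div_mul_eq_mul_div, le_div_iff₀ hm]
      linarith
    simp only
    rw [Real.smoothTransition.one_of_one_le (by linarith), one_mul,
      inv_mul_cancel₀ (hm.trans_le hx).ne']

/-- The oscillatory integral `∫ e^{iφ(ξ)} a(ξ) dξ` with phase `φ` and amplitude `a`. -/
def oscIntegral {E : Type*} [MeasureSpace E] (φ : E → ℝ) (a : E → ℂ) : ℂ :=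
  ∫ ξ, Complex.exp (Complex.I * φ ξ) * a ξ

theorem norm_oscIntegral_le {E : Type*} [MeasureSpace E] (φ : E → ℝ) (a : E → ℂ) :
    ‖oscIntegral φ a‖ ≤ ∫ ξ, ‖a ξ‖ := by
  refine (norm_integral_le_integral_norm _).trans_eq ?_
  simp_rw [norm_mul, Complex.norm_exp_I_mul_ofReal, one_mul]

theorem exists_forall_norm_oscIntegral_le {P E : Type*} [TopologicalSpace P] [TopologicalSpace E]
    [MeasureSpace E] [IsFiniteMeasureOnCompacts (volume : Measure E)] {K : Set P} {S : Set E}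
    (hK : IsCompact K) (hS : IsCompact S) {b : P × E → ℂ} (hb : Continuous b)
    (hbS : ∀ p ∈ K, ∀ η ∉ S, b (p, η) = 0) :
    ∃ C, ∀ p ∈ K, ∀ ψ : E → ℝ, ‖oscIntegral ψ (fun η => b (p, η))‖ ≤ C := by
  obtain ⟨C, hC⟩ := (hK.prod hS).exists_bound_of_continuousOn hb.continuousOn
  refine ⟨C * volume.real S, fun p hp ψ => (norm_oscIntegral_le _ _).trans ?_⟩
  rw [← setIntegral_eq_integral_of_forall_compl_eq_zero
    fun η hη => by rw [hbS p hp η hη, norm_zero]]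
  refine (Real.le_norm_self _).trans
    (norm_setIntegral_le_of_norm_le_const hS.measure_lt_top fun η hη => ?_)
  rw [norm_norm]
  exact hC (p, η) ⟨hp, hη⟩

section NonstationaryPhase

variable {E : Type*} [NormedAddCommGroup E] [NormedSpace ℝ E]

theorem fderiv_cexp_I_mul_ofReal {ψ : E → ℝ} {η : E} (hψ : DifferentiableAt ℝ ψ η) (v : E) :
    fderiv ℝ (fun η => Complex.exp (Complex.I * ψ η)) η v =
      Complex.exp (Complex.I * ψ η) * (Complex.I * fderiv ℝ ψ η v) := by
  have hψc : HasFDerivAt (fun η => (ψ η : ℂ)) (Complex.ofRealCLM.comp (fderiv ℝ ψ η)) η :=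
    Complex.ofRealCLM.hasFDerivAt.comp η hψ.hasFDerivAt
  rw [(hψc.const_mul Complex.I).cexp.fderiv]
  simp

/-- For a multiplier `G` and a direction field `v`, both depending on a parameter `p`, the amplitude
`-∂_{v(p)} (G b)` produced from `b` by one integration by parts in the variable `η`. -/
def transposedDeriv {P : Type*} (G : P × E → ℝ) (v : P → E) (b : P × E → ℂ) (q : P × E) : ℂ :=
  -fderiv ℝ (fun η => G (q.1, η) • b (q.1, η)) q.2 (v q.1)

theorem contDiff_transposedDeriv {P : Type*} [NormedAddCommGroup P] [NormedSpace ℝ P]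
    {G : P × E → ℝ} (hG : ContDiff ℝ ∞ G) {v : P → E} (hv : ContDiff ℝ ∞ v) {b : P × E → ℂ}
    (hb : ContDiff ℝ ∞ b) : ContDiff ℝ ∞ (transposedDeriv G v b) := by
  have hslice : ContDiff ℝ ∞ fun z : (P × E) × E => (z.1.1, z.2) := by fun_prop
  exact (ContDiff.fderiv_apply (f := fun q : P × E => fun η => G (q.1, η) • b (q.1, η))
    ((hG.comp hslice).smul (hb.comp hslice)) contDiff_snd (hv.comp contDiff_fst) le_rfl).neg

theorem transposedDeriv_eq_zero {P : Type*} {G : P × E → ℝ} {v : P → E} {b : P × E → ℂ} {p : P}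
    {S : Set E} (hS : IsClosed S) (hbS : ∀ η ∉ S, b (p, η) = 0) {η : E} (hη : η ∉ S) :
    transposedDeriv G v b (p, η) = 0 := by
  have hzero : (fun η => G (p, η) • b (p, η)) =ᶠ[𝓝 η] fun _ => 0 := by
    filter_upwards [hS.isOpen_compl.mem_nhds hη] with y hy
    rw [hbS y hy, smul_zero]
  rw [transposedDeriv, hzero.fderiv_eq]
  simp

variable [FiniteDimensional ℝ E] [MeasureSpace E] [BorelSpace E]
  [(volume : Measure E).IsAddHaarMeasure]

theorem oscIntegral_neg_fderiv {ψ : E → ℝ} (hψ : ContDiff ℝ 1 ψ) {k : E → ℂ}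
    (hk : ContDiff ℝ 1 k) (hks : HasCompactSupport k) (v : E) :
    oscIntegral ψ (fun η => -fderiv ℝ k η v) =
      Complex.I * oscIntegral ψ (fun η => fderiv ℝ ψ η v • k η) := by
  set e : E → ℂ := fun η => Complex.exp (Complex.I * ψ η)
  have he : ContDiff ℝ 1 e := (contDiff_const.mul (Complex.ofRealCLM.contDiff.comp hψ)).cexp
  have hderiv {f : E → ℂ} (hf : ContDiff ℝ 1 f) : Continuous fun η => fderiv ℝ f η v :=
    (hf.continuous_fderiv one_ne_zero).clm_apply continuous_const
  have hIBP := integral_mul_fderiv_eq_neg_fderiv_mul_of_integrable (μ := volume) (v := v)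
    (((hderiv he).mul hk.continuous).integrable_of_hasCompactSupport hks.mul_left)
    ((he.continuous.mul (hderiv hk)).integrable_of_hasCompactSupport
      (hks.fderiv_apply ℝ v).mul_left)
    ((he.continuous.mul hk.continuous).integrable_of_hasCompactSupport hks.mul_left)
    (fun η _ => he.differentiable one_ne_zero η) (fun η _ => hk.differentiable one_ne_zero η)
  rw [oscIntegral, oscIntegral, ← integral_const_mul]
  simp_rw [mul_neg]
  rw [integral_neg, hIBP, neg_neg]
  congr with η
  rw [fderiv_cexp_I_mul_ofReal (hψ.differentiable one_ne_zero η), Complex.real_smul]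
  ring

variable {P : Type*}

theorem oscIntegral_transposedDeriv {G g : P × E → ℝ} {v : P → E} {b : P × E → ℂ} {p : P}
    {S : Set E} (hG : ContDiff ℝ 1 fun η => G (p, η)) (hb : ContDiff ℝ 1 fun η => b (p, η))
    (hS : IsCompact S) (hbS : ∀ η ∉ S, b (p, η) = 0) (hGg : ∀ η ∈ S, G (p, η) * g (p, η) = 1)
    {ψ : E → ℝ} (hψ : ContDiff ℝ 1 ψ) {c : ℝ}
    (hψg : ∀ η ∈ S, fderiv ℝ ψ η (v p) = c * g (p, η)) :
    oscIntegral ψ (fun η => transposedDeriv G v b (p, η)) =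
      Complex.I * c * oscIntegral ψ (fun η => b (p, η)) := by
  refine (oscIntegral_neg_fderiv hψ (hG.smul hb)
    (HasCompactSupport.intro hS fun η hη => by simp [hbS η hη]) (v p)).trans ?_
  rw [mul_assoc, oscIntegral, oscIntegral, ← integral_const_mul (c : ℂ)]
  congr with η
  by_cases hη : η ∈ S
  · have hGg' : (G (p, η) : ℂ) * g (p, η) = 1 := mod_cast hGg η hη
    simp only [Pi.smul_apply', hψg η hη, Complex.real_smul, Complex.ofReal_mul]
    linear_combination (Complex.exp (Complex.I * ψ η) * c * b (p, η)) * hGg'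
  · simp [hbS η hη]

variable [NormedAddCommGroup P] [NormedSpace ℝ P]

theorem exists_forall_abs_pow_mul_norm_oscIntegral_le {K : Set P} {S : Set E} (hK : IsCompact K)
    (hS : IsCompact S) {g : P × E → ℝ} (hg : ContDiff ℝ ∞ g) (hpos : ∀ q ∈ K ×ˢ S, 0 < g q)
    {v : P → E} (hv : ContDiff ℝ ∞ v) {b : P × E → ℂ} (hb : ContDiff ℝ ∞ b)
    (hbS : ∀ p ∈ K, ∀ η ∉ S, b (p, η) = 0) (N : ℕ) :
    ∃ C, ∀ p ∈ K, ∀ ψ : E → ℝ, ContDiff ℝ 1 ψ → ∀ c : ℝ,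
      (∀ η ∈ S, fderiv ℝ ψ η (v p) = c * g (p, η)) →
      |c| ^ N * ‖oscIntegral ψ (fun η => b (p, η))‖ ≤ C := by
  obtain ⟨m, hm, hmg⟩ := (hK.prod hS).exists_forall_le' hg.continuous.continuousOn hpos
  obtain ⟨G₀, hG₀, hG₀inv⟩ := exists_contDiff_forall_ge_mul_eq_one hm
  have hG : ContDiff ℝ ∞ (G₀ ∘ g) := hG₀.comp hg
  have hslice (p : P) : ContDiff ℝ 1 fun η : E => (p, η) := by fun_prop
  induction N generalizing b with
  | zero =>
    obtain ⟨C, hC⟩ := exists_forall_norm_oscIntegral_le hK hS hb.continuous hbS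
    exact ⟨C, fun p hp ψ _ c _ => by simpa using hC p hp ψ⟩
  | succ N ih =>
    obtain ⟨C, hC⟩ := ih (contDiff_transposedDeriv hG hv hb)
      fun p hp η => transposedDeriv_eq_zero hS.isClosed (hbS p hp)
    refine ⟨C, fun p hp ψ hψ c hc => ?_⟩
    have hstep := hC p hp ψ hψ c hc
    rw [oscIntegral_transposedDeriv (g := g) ((hG.of_le ENat.LEInfty.out).comp (hslice p))
      ((hb.of_le ENat.LEInfty.out).comp (hslice p)) hS (hbS p hp)
      (fun η hη => hG₀inv _ (hmg _ ⟨hp, hη⟩)) hψ hc, norm_mul, norm_mul, Complex.norm_I, one_mul,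
      Complex.norm_real, Real.norm_eq_abs, ← mul_assoc, ← pow_succ] at hstep
    exact hstep

end NonstationaryPhase

section AveragedHessian

variable {E : Type*} [NormedAddCommGroup E]

/-- The second derivative of `F` at `ξ` is nondegenerate as a bilinear form. -/
def HasRegularHessianAt [NormedSpace ℝ E] (F : E → ℝ) (ξ : E) : Prop :=
  ∀ w, fderiv ℝ (fderiv ℝ F) ξ w = 0 → w = 0

/-- The mean `∫₀¹ D²Φ(η + s r w)(w, B w) ds` of the second derivative in the directions `w` and
`B w` over the segment from `η` to `η + r w`, as a function of `((w, r), η)`. -/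
def averagedHessian [NormedSpace ℝ E] (Φ : E → ℝ) (B : E →L[ℝ] E) (q : (E × ℝ) × E) : ℝ :=
  ∫ s in (0 : ℝ)..1, fderiv ℝ (fderiv ℝ Φ) (q.2 + (s * q.1.2) • q.1.1) q.1.1 (B q.1.1)

theorem contDiff_averagedHessian [NormedSpace ℝ E] [FiniteDimensional ℝ E] {Φ : E → ℝ}
    (hΦ : ContDiff ℝ ∞ Φ) (B : E →L[ℝ] E) : ContDiff ℝ ∞ (averagedHessian Φ B) := by
  have hΦ₂ : ContDiff ℝ ∞ (fderiv ℝ (fderiv ℝ Φ)) :=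
    (hΦ.fderiv_right (m := ∞) (by simp)).fderiv_right (m := ∞) (by simp)
  refine contDiff_intervalIntegral 0 1 (H := (E × ℝ) × E) (f := fun x =>
    fderiv ℝ (fderiv ℝ Φ) (x.1.2 + (x.2 * x.1.1.2) • x.1.1.1) x.1.1.1 (B x.1.1.1)) ?_
  refine ((hΦ₂.comp ?_).clm_apply ?_).clm_apply ?_ <;> fun_prop

theorem fderiv_add_smul_sub_fderiv [NormedSpace ℝ E] {Φ : E → ℝ} (hΦ : ContDiff ℝ 2 Φ)
    (B : E →L[ℝ] E) (w : E) (r : ℝ) (η : E) :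
    fderiv ℝ Φ (η + r • w) (B w) - fderiv ℝ Φ η (B w) = r * averagedHessian Φ B ((w, r), η) := by
  have hΦ₁ : ContDiff ℝ 1 (fderiv ℝ Φ) := hΦ.fderiv_right (m := 1) (by norm_num)
  have hderiv (s : ℝ) : HasDerivAt (fun s : ℝ => fderiv ℝ Φ (η + (s * r) • w) (B w))
      (r * fderiv ℝ (fderiv ℝ Φ) (η + (s * r) • w) w (B w)) s := by
    have hline : HasDerivAt (fun s : ℝ => η + (s * r) • w) (r • w) s := by
      simpa using (((hasDerivAt_id s).mul_const r).smul_const w).const_add η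
    simpa using ((hΦ₁.differentiable one_ne_zero _).hasFDerivAt.comp_hasDerivAt s hline).clm_apply
      (hasDerivAt_const s (B w))
  have hcont : Continuous fun s : ℝ => r * fderiv ℝ (fderiv ℝ Φ) (η + (s * r) • w) w (B w) := by
    refine continuous_const.mul ((((hΦ₁.continuous_fderiv one_ne_zero).comp ?_).clm_apply
      continuous_const).clm_apply continuous_const)
    fun_prop
  have hFTC := intervalIntegral.integral_eq_sub_of_hasDerivAt (a := 0) (b := 1)
    (fun s _ => hderiv s) (hcont.intervalIntegrable _ _)
  rw [intervalIntegral.integral_const_mul] at hFTC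
  simp only [one_mul, zero_mul, zero_smul, add_zero] at hFTC
  exact hFTC.symm

variable [InnerProductSpace ℝ E] [FiniteDimensional ℝ E]

theorem apply_toDual_symm_self (L : StrongDual ℝ E) :
    L ((InnerProductSpace.toDual ℝ E).symm L) = ‖L‖ ^ 2 := by
  rw [← InnerProductSpace.toDual_symm_apply, real_inner_self_eq_norm_sq,
    LinearIsometryEquiv.norm_map]

theorem exists_forall_averagedHessian_pos {Φ : E → ℝ} (hΦ : ContDiff ℝ ∞ Φ) {ξ₀ : E}
    (hreg : HasRegularHessianAt Φ ξ₀) :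
    ∃ B : E →L[ℝ] E, ∃ δ > 0, ∀ q ∈ (Metric.sphere (0 : E) 1 ×ˢ Icc 0 (2 * δ)) ×ˢ
      Metric.closedBall ξ₀ δ, 0 < averagedHessian Φ B q := by
  set A := fderiv ℝ (fderiv ℝ Φ) ξ₀
  let B : E →L[ℝ] E :=
    (InnerProductSpace.toDual ℝ E).symm.toContinuousLinearEquiv.toContinuousLinearMap.comp A
  have hcenter : ∀ w ∈ Metric.sphere (0 : E) 1, 0 < averagedHessian Φ B ((w, 0), ξ₀) := by
    intro w hw
    have hne : A w ≠ 0 := fun h => by simp [hreg w h] at hw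
    have hB : B w = (InnerProductSpace.toDual ℝ E).symm (A w) := rfl
    have heq : averagedHessian Φ B ((w, 0), ξ₀) = ‖A w‖ ^ 2 := by
      simp [averagedHessian, A, hB, apply_toDual_symm_self]
    rw [heq]
    positivity
  have hnear : ∀ᶠ z : ℝ × E in 𝓝 (0, ξ₀), ∀ w ∈ Metric.sphere (0 : E) 1,
      0 < averagedHessian Φ B ((w, z.1), z.2) := by
    refine (isCompact_sphere (0 : E) 1).eventually_forall_of_forall_eventually fun w hw => ?_
    have hcont : Continuous fun z : (ℝ × E) × E => averagedHessian Φ B ((z.2, z.1.1), z.1.2) :=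
      (contDiff_averagedHessian hΦ B).continuous.comp (by fun_prop)
    exact hcont.continuousAt.eventually (lt_mem_nhds (hcenter w hw))
  obtain ⟨ε, hε, hball⟩ := Metric.nhds_basis_closedBall.eventually_iff.1 hnear
  refine ⟨B, ε / 2, by positivity, fun q hq => hball (x := (q.1.2, q.2)) ?_ q.1.1 hq.1.1⟩
  have hr : q.1.2 ∈ Metric.closedBall (0 : ℝ) ε := by
    rw [mem_closedBall_zero_iff, Real.norm_of_nonneg hq.1.2.1]
    linarith [hq.1.2.2]
  rw [← closedBall_prod_same]
  exact ⟨hr, Metric.closedBall_subset_closedBall (by linarith) hq.2⟩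

end AveragedHessian

section Dispersive

variable {E : Type*} [NormedAddCommGroup E]

theorem one_add_pow_mul_le {x y C₀ C₁ : ℝ} (hx : 0 ≤ x) (hy : 0 ≤ y) (n : ℕ) (h₀ : y ≤ C₀)
    (h₁ : x ^ n * y ≤ C₁) : (1 + x) ^ n * y ≤ 2 ^ (n - 1) * (C₀ + C₁) := by
  calc (1 + x) ^ n * y ≤ 2 ^ (n - 1) * (1 ^ n + x ^ n) * y := by
        gcongr
        exact add_pow_le zero_le_one hx n
    _ = 2 ^ (n - 1) * (y + x ^ n * y) := by ring
    _ ≤ 2 ^ (n - 1) * (C₀ + C₁) := by gcongr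

theorem exists_eq_norm_smul_of_nontrivial [NormedSpace ℝ E] [Nontrivial E] (h : E) :
    ∃ w ∈ Metric.sphere (0 : E) 1, ‖h‖ • w = h := by
  rcases eq_or_ne h 0 with rfl | hh
  · obtain ⟨w, hw⟩ := exists_norm_eq E zero_le_one
    exact ⟨w, by simpa using hw, by simp⟩
  · have hne : ‖h‖ ≠ 0 := norm_ne_zero_iff.2 hh
    exact ⟨‖h‖⁻¹ • h, by simp [norm_smul, hne], by simp [smul_smul, hne]⟩

/-- The oscillatory integral `∫ e^{i(φ(η + h) - φ(η))} a(η + h) \overline{a(η)} dη`, that is, the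
autocorrelation of `e^{iφ} a` at the shift `h`. -/
def oscCorrelation [MeasureSpace E] (φ : E → ℝ) (a : E → ℂ) (h : E) : ℂ :=
  oscIntegral (fun η => φ (η + h) - φ η) (fun η => a (η + h) * (starRingEnd ℂ) (a η))

theorem oscCorrelation_eq_integral [MeasureSpace E] (φ : E → ℝ) (a : E → ℂ) (h : E) :
    oscCorrelation φ a h = ∫ η, (Complex.exp (Complex.I * φ (η + h)) * a (η + h)) *
      (starRingEnd ℂ) (Complex.exp (Complex.I * φ η) * a η) := by
  unfold oscCorrelation oscIntegral
  congr with η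
  rw [map_mul, ← Complex.exp_conj, map_mul, Complex.conj_I, Complex.conj_ofReal,
    mul_mul_mul_comm, ← Complex.exp_add]
  push_cast
  ring_nf

theorem oscCorrelation_eq_zero [MeasureSpace E] (φ : E → ℝ) {a : E → ℂ} {ξ₀ : E} {δ : ℝ}
    (ha : ∀ ξ ∉ Metric.closedBall ξ₀ δ, a ξ = 0) {h : E} (hh : 2 * δ < ‖h‖) :
    oscCorrelation φ a h = 0 := by
  have hzero (η : E) : a (η + h) * (starRingEnd ℂ) (a η) = 0 := by
    by_contra hne
    obtain ⟨h₁, h₂⟩ : η + h ∈ Metric.closedBall ξ₀ δ ∧ η ∈ Metric.closedBall ξ₀ δ := by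
      refine ⟨?_, ?_⟩ <;> by_contra hη <;> simp [ha _ hη] at hne
    have hdist := (dist_triangle_right (η + h) η ξ₀).trans (add_le_add h₁ h₂)
    rw [dist_self_add_left] at hdist
    linarith
  simp [oscCorrelation, oscIntegral, hzero]

variable [InnerProductSpace ℝ E] [FiniteDimensional ℝ E] [MeasurableSpace E] [BorelSpace E]

theorem norm_oscCorrelation_add_inner (φ : E → ℝ) (a : E → ℂ) (x h : E) :
    ‖oscCorrelation (fun ξ => φ ξ + inner ℝ ξ x) a h‖ = ‖oscCorrelation φ a h‖ := by
  have hphase : oscCorrelation (fun ξ => φ ξ + inner ℝ ξ x) a h =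
      Complex.exp (Complex.I * (inner ℝ h x : ℝ)) * oscCorrelation φ a h := by
    unfold oscCorrelation oscIntegral
    rw [← integral_const_mul]
    congr with η
    simp only [inner_add_left]
    rw [← mul_assoc (Complex.exp _) (Complex.exp _), ← Complex.exp_add]
    push_cast
    ring_nf
  rw [hphase, norm_mul, Complex.norm_exp_I_mul_ofReal, one_mul]

theorem norm_sq_oscIntegral_le {φ : E → ℝ} {a : E → ℂ}
    (h : Integrable fun ξ => Complex.exp (Complex.I * φ ξ) * a ξ) :
    ‖oscIntegral φ a‖ ^ 2 ≤ ∫ h, ‖oscCorrelation φ a h‖ := by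
  set u : E → ℂ := fun ξ => Complex.exp (Complex.I * φ ξ) * a ξ
  have hshift : Integrable (fun z : E × E => u (z.2 + z.1) * (starRingEnd ℂ) (u z.2))
      (volume.prod volume) := by
    have hprod : Integrable (fun z : E × E => u z.1 * (starRingEnd ℂ) (u z.2))
        (volume.prod volume) :=
      h.mul_prod (Complex.conjCLE.toContinuousLinearMap.integrable_comp h)
    simpa only [Function.comp_def, add_comm] using
      (measurePreserving_add_prod (G := E) volume volume).integrable_comp_of_integrable hprod
  have hfubini : ∫ h, oscCorrelation φ a h = ((‖oscIntegral φ a‖ ^ 2 : ℝ) : ℂ) := by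
    have hcorr (h : E) : oscCorrelation φ a h = ∫ η, u (η + h) * (starRingEnd ℂ) (u η) :=
      oscCorrelation_eq_integral φ a h
    simp_rw [hcorr]
    rw [integral_integral_swap hshift]
    simp_rw [integral_mul_const, integral_add_left_eq_self u]
    rw [integral_const_mul, integral_conj, Complex.mul_conj, Complex.normSq_eq_norm_sq]
    rfl
  have hnorm := norm_integral_le_integral_norm (oscCorrelation φ a) (μ := volume)
  rwa [hfubini, Complex.norm_real, Real.norm_of_nonneg (by positivity)] at hnorm

theorem exists_pow_mul_norm_oscCorrelation_le [Nontrivial E] {Φ : E → ℝ} (hΦ : ContDiff ℝ ∞ Φ)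
    {ξ₀ : E} (hreg : HasRegularHessianAt Φ ξ₀) :
    ∃ δ > 0, ∀ a : E → ℂ, ContDiff ℝ ∞ a → (∀ ξ ∉ Metric.closedBall ξ₀ δ, a ξ = 0) →
      ∀ N : ℕ, ∃ C, ∀ (t : ℝ) (h : E),
        (|t| * ‖h‖) ^ N * ‖oscCorrelation (fun ξ => t * Φ ξ) a h‖ ≤ C := by
  obtain ⟨B, δ, hδ, hpos⟩ := exists_forall_averagedHessian_pos hΦ hreg
  refine ⟨δ, hδ, fun a ha haδ N => ?_⟩
  have hb : ContDiff ℝ ∞ fun q : (E × ℝ) × E =>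
      a (q.2 + q.1.2 • q.1.1) * (starRingEnd ℂ) (a q.2) :=
    (ha.comp (by fun_prop)).mul (Complex.conjCLE.contDiff.comp (ha.comp contDiff_snd))
  have hv : ContDiff ℝ ∞ fun p : E × ℝ => B p.1 := by fun_prop
  obtain ⟨C, hC⟩ := exists_forall_abs_pow_mul_norm_oscIntegral_le
    ((isCompact_sphere (0 : E) 1).prod isCompact_Icc) (isCompact_closedBall ξ₀ δ)
    (contDiff_averagedHessian hΦ B) hpos hv hb (fun p _ η hη => by simp [haδ η hη]) N
  refine ⟨max C 0, fun t h => ?_⟩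
  rcases lt_or_ge (2 * δ) ‖h‖ with hh | hh
  · simp [oscCorrelation_eq_zero _ haδ hh]
  obtain ⟨w, hw, hwh⟩ := exists_eq_norm_smul_of_nontrivial h
  have hderiv (η : E) : fderiv ℝ (fun η => t * Φ (η + h) - t * Φ η) η (B w) =
      (t * ‖h‖) * averagedHessian Φ B ((w, ‖h‖), η) := by
    have hd (ξ : E) := (hΦ.differentiable (by simp) ξ).hasFDerivAt
    rw [((((hasFDerivAt_comp_add_right h).2 (hd (η + h))).const_mul t).fun_sub
      ((hd η).const_mul t)).fderiv, mul_assoc,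
      ← fderiv_add_smul_sub_fderiv (hΦ.of_le ENat.LEInfty.out), hwh]
    simp [mul_sub]
  have hψ : ContDiff ℝ ∞ fun η => t * Φ (η + h) - t * Φ η := by fun_prop
  have hbound := hC (w, ‖h‖) ⟨hw, norm_nonneg h, hh⟩ _ (hψ.of_le ENat.LEInfty.out) (t * ‖h‖)
    fun η _ => hderiv η
  rw [abs_mul, abs_norm] at hbound
  simp only [hwh] at hbound
  exact hbound.trans (le_max_left C 0)

theorem integral_one_add_abs_mul_norm_rpow (t : ℝ) (r : ℝ) :
    ∫ h : E, (1 + |t| * ‖h‖) ^ (-r) =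
      (|t| ^ Module.finrank ℝ E)⁻¹ * ∫ h : E, (1 + ‖h‖) ^ (-r) := by
  simpa only [norm_smul, Real.norm_eq_abs, abs_inv, abs_pow, smul_eq_mul] using
    Measure.integral_comp_smul (volume : Measure E) (fun h : E => (1 + ‖h‖) ^ (-r)) t

theorem integral_norm_le_of_forall_pow_mul_norm_le {J : E → ℂ} {C t : ℝ} (ht : t ≠ 0) {N : ℕ}
    (hN : Module.finrank ℝ E < N) (hJ : ∀ h, (1 + |t| * ‖h‖) ^ N * ‖J h‖ ≤ C) :
    ∫ h, ‖J h‖ ≤ C * ((|t| ^ Module.finrank ℝ E)⁻¹ * ∫ h : E, (1 + ‖h‖) ^ (-(N : ℝ))) := by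
  have hinteg : Integrable fun h : E => (1 + |t| * ‖h‖) ^ (-(N : ℝ)) := by
    simpa only [norm_smul, Real.norm_eq_abs] using
      (integrable_one_add_norm (E := E) (μ := volume) (Nat.cast_lt.2 hN)).comp_smul ht
  rw [← integral_one_add_abs_mul_norm_rpow, ← integral_const_mul]
  refine integral_mono_of_nonneg (.of_forall fun h => norm_nonneg _) (hinteg.const_mul _)
    (.of_forall fun h => ?_)
  simp only
  rw [Real.rpow_neg (by positivity), Real.rpow_natCast, ← div_eq_mul_inv,
    le_div_iff₀ (by positivity), mul_comm]
  exact hJ h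

theorem one_le_japanese (t : ℝ) : 1 ≤ japanese t := by
  rw [japanese, Real.one_le_sqrt]
  nlinarith [sq_nonneg |t|]

theorem japanese_le_one_add_abs (t : ℝ) : japanese t ≤ 1 + |t| := by
  rw [japanese, Real.sqrt_le_left (by positivity)]
  nlinarith [abs_nonneg t]

theorem exists_abs_pow_mul_norm_sq_oscIntegral_le [Nontrivial E] {Φ : E → ℝ}
    (hΦ : ContDiff ℝ ∞ Φ) {ξ₀ : E} (hreg : HasRegularHessianAt Φ ξ₀) :
    ∃ δ > 0, ∀ a : E → ℂ, ContDiff ℝ ∞ a → (∀ ξ ∉ Metric.closedBall ξ₀ δ, a ξ = 0) →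
      ∃ C, ∀ (t : ℝ) (x : E), |t| ^ Module.finrank ℝ E *
        ‖oscIntegral (fun ξ => t * Φ ξ + inner ℝ ξ x) a‖ ^ 2 ≤ C := by
  obtain ⟨δ, hδ, hcorr⟩ := exists_pow_mul_norm_oscCorrelation_le hΦ hreg
  refine ⟨δ, hδ, fun a ha haδ => ?_⟩
  set d := Module.finrank ℝ E
  obtain ⟨C₀, hC₀⟩ := hcorr a ha haδ 0
  obtain ⟨C₁, hC₁⟩ := hcorr a ha haδ (d + 1)
  have hdecay (t : ℝ) (h : E) : (1 + |t| * ‖h‖) ^ (d + 1) *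
      ‖oscCorrelation (fun ξ => t * Φ ξ) a h‖ ≤ 2 ^ d * (C₀ + C₁) :=
    one_add_pow_mul_le (by positivity) (norm_nonneg _) (d + 1) (by simpa using hC₀ t h) (hC₁ t h)
  set C := 2 ^ d * (C₀ + C₁) * ∫ h : E, (1 + ‖h‖) ^ (-((d + 1 : ℕ) : ℝ))
  refine ⟨max C 0, fun t x => ?_⟩
  rcases eq_or_ne t 0 with rfl | ht
  · simp [d, Module.finrank_pos.ne']
  have hinteg : Integrable fun ξ =>
      Complex.exp (Complex.I * (t * Φ ξ + inner ℝ ξ x : ℝ)) * a ξ := by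
    have hcont := hΦ.continuous
    have hacont := ha.continuous
    exact Continuous.integrable_of_hasCompactSupport (by fun_prop)
      (HasCompactSupport.intro (isCompact_closedBall ξ₀ δ) fun ξ hξ => by simp [haδ ξ hξ])
  have hsq := norm_sq_oscIntegral_le hinteg
  simp_rw [norm_oscCorrelation_add_inner] at hsq
  calc |t| ^ d * ‖oscIntegral (fun ξ => t * Φ ξ + inner ℝ ξ x) a‖ ^ 2
      ≤ |t| ^ d * (2 ^ d * (C₀ + C₁) * ((|t| ^ d)⁻¹ *
          ∫ h : E, (1 + ‖h‖) ^ (-((d + 1 : ℕ) : ℝ)))) := by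
        gcongr
        exact hsq.trans (integral_norm_le_of_forall_pow_mul_norm_le ht d.lt_succ_self (hdecay t))
    _ = C := by simp only [C]; field_simp
    _ ≤ max C 0 := le_max_left C 0

theorem exists_norm_oscIntegral_le_japanese_rpow [Nontrivial E] {Φ : E → ℝ}
    (hΦ : ContDiff ℝ ∞ Φ) {ξ₀ : E} (hreg : HasRegularHessianAt Φ ξ₀) :
    ∃ δ > 0, ∀ a : E → ℂ, ContDiff ℝ ∞ a → (∀ ξ ∉ Metric.closedBall ξ₀ δ, a ξ = 0) →
      ∃ C, ∀ (t : ℝ) (x : E), ‖oscIntegral (fun ξ => t * Φ ξ + inner ℝ ξ x) a‖ ≤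
        C * japanese t ^ (-(Module.finrank ℝ E : ℝ) / 2) := by
  obtain ⟨δ, hδ, hdecay⟩ := exists_abs_pow_mul_norm_sq_oscIntegral_le hΦ hreg
  refine ⟨δ, hδ, fun a ha haδ => ?_⟩
  set d := Module.finrank ℝ E
  obtain ⟨C, hC⟩ := hdecay a ha haδ
  set D := 2 ^ (d - 1) * ((∫ ξ, ‖a ξ‖) ^ 2 + C)
  refine ⟨√D, fun t x => ?_⟩
  set I := oscIntegral (fun ξ => t * Φ ξ + inner ℝ ξ x) a
  have hj : 0 < japanese t := zero_lt_one.trans_le (one_le_japanese t)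
  have hsq : japanese t ^ d * ‖I‖ ^ 2 ≤ D := by
    refine le_trans ?_ (one_add_pow_mul_le (abs_nonneg t) (sq_nonneg ‖I‖) d
      (pow_le_pow_left₀ (norm_nonneg _) (norm_oscIntegral_le _ _) 2) (hC t x))
    gcongr
    exact japanese_le_one_add_abs t
  rw [neg_div, Real.rpow_neg hj.le, ← div_eq_mul_inv, le_div_iff₀ (by positivity)]
  refine Real.le_sqrt_of_sq_le ?_
  rw [mul_pow, ← Real.rpow_mul_natCast hj.le, Nat.cast_two, div_mul_cancel₀ _ two_ne_zero,
    Real.rpow_natCast, mul_comm]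
  exact hsq

end Dispersive

theorem fourierHat_eq_fourier {d : ℕ} (f : Euc d → ℂ) (ξ : Euc d) :
    fourierHat f ξ = (1 / (2 * (Real.pi : ℂ)) ^ d) * 𝓕 f ((2 * Real.pi)⁻¹ • ξ) := by
  rw [fourierHat, Real.fourier_eq']
  congr with x
  have hpi : (Real.pi : ℂ) ≠ 0 := mod_cast Real.pi_ne_zero
  rw [smul_eq_mul, mul_comm, real_inner_comm, inner_smul_right]
  congr 2
  push_cast
  field_simp

theorem multiplierOp_eq_oscIntegral {d : ℕ} (Φ : Euc d → ℝ) (t : ℝ) (f : 𝓢(Euc d, ℂ))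
    (x : Euc d) :
    multiplierOp Φ t f x = oscIntegral
      (fun ξ => t * Φ ((2 * Real.pi) • ξ) + inner ℝ ξ ((2 * Real.pi) • x)) (fun ξ => 𝓕 f ξ) := by
  have hpi : 2 * Real.pi ≠ 0 := by positivity
  have hpc : 2 * (Real.pi : ℂ) ≠ 0 := mod_cast hpi
  let u : Euc d → ℂ := fun ξ =>
    Complex.exp (Complex.I * (t * Φ ((2 * Real.pi) • ξ) + inner ℝ ξ ((2 * Real.pi) • x) : ℝ)) *
      𝓕 f ξ
  have hscale : multiplierOp Φ t f x =
      (1 / (2 * (Real.pi : ℂ)) ^ d) * ∫ ξ, u ((2 * Real.pi)⁻¹ • ξ) := by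
    rw [multiplierOp, ← integral_const_mul]
    congr with ξ
    simp only [u]
    rw [fourierHat_eq_fourier, smul_inv_smul₀ hpi, real_inner_smul_left, real_inner_smul_right,
      inv_mul_cancel_left₀ hpi, SchwartzMap.fourier_coe, mul_left_comm, ← mul_add]
    push_cast
    rfl
  rw [hscale, Measure.integral_comp_smul, finrank_euclideanSpace_fin, abs_of_nonneg (by positivity),
    inv_pow, inv_inv, Complex.real_smul, ← mul_assoc]
  push_cast
  rw [one_div_mul_cancel (pow_ne_zero d hpc), one_mul]
  rfl

section ModulatedAmplitude

variable {d : ℕ} {Ψ : Euc d → ℝ} {a : Euc d → ℂ}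

/-- The function `e^{isΨ} a`, for a smooth phase `Ψ` and a smooth compactly supported amplitude
`a`, as a Schwartz function. -/
def modulatedAmplitude (hΨ : ContDiff ℝ ∞ Ψ) (ha : ContDiff ℝ ∞ a) (has : HasCompactSupport a)
    (s : ℝ) : 𝓢(Euc d, ℂ) :=
  (has.mul_left (f := fun ξ => Complex.exp (Complex.I * (s * Ψ ξ : ℝ)))).toSchwartzMap
    ((contDiff_const.mul
      (Complex.ofRealCLM.contDiff.comp (contDiff_const.mul hΨ))).cexp.mul ha)

theorem modulatedAmplitude_apply (hΨ : ContDiff ℝ ∞ Ψ) (ha : ContDiff ℝ ∞ a)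
    (has : HasCompactSupport a) (s : ℝ) (ξ : Euc d) :
    modulatedAmplitude hΨ ha has s ξ = Complex.exp (Complex.I * (s * Ψ ξ : ℝ)) * a ξ :=
  rfl

theorem fourierInv_modulatedAmplitude_apply (hΨ : ContDiff ℝ ∞ Ψ) (ha : ContDiff ℝ ∞ a)
    (has : HasCompactSupport a) (s : ℝ) (x : Euc d) :
    (𝓕⁻ (modulatedAmplitude hΨ ha has s)) x =
      oscIntegral (fun ξ => s * Ψ ξ + inner ℝ ξ ((2 * Real.pi) • x)) a := by
  rw [SchwartzMap.fourierInv_coe, Real.fourierInv_eq']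
  unfold oscIntegral
  congr with ξ
  simp only [modulatedAmplitude_apply, smul_eq_mul, ← mul_assoc, ← Complex.exp_add,
    real_inner_smul_right]
  congr 2
  push_cast
  ring

theorem integral_norm_sq_fourierInv_modulatedAmplitude (hΨ : ContDiff ℝ ∞ Ψ)
    (ha : ContDiff ℝ ∞ a) (has : HasCompactSupport a) (s : ℝ) :
    ∫ x, ‖(𝓕⁻ (modulatedAmplitude hΨ ha has s)) x‖ ^ 2 = ∫ ξ, ‖a ξ‖ ^ 2 := by
  rw [← SchwartzMap.integral_norm_sq_fourier, FourierTransform.fourier_fourierInv_eq]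
  simp_rw [modulatedAmplitude_apply, norm_mul, Complex.norm_exp_I_mul_ofReal, one_mul]

theorem multiplierOp_fourierInv_modulatedAmplitude (hΨ : ContDiff ℝ ∞ Ψ) (ha : ContDiff ℝ ∞ a)
    (has : HasCompactSupport a) {Φ : Euc d → ℝ}
    (hΦΨ : ∀ ξ, a ξ ≠ 0 → Φ ((2 * Real.pi) • ξ) = Ψ ξ) (s t : ℝ) (x : Euc d) :
    multiplierOp Φ t (𝓕⁻ (modulatedAmplitude hΨ ha has s)) x =
      (𝓕⁻ (modulatedAmplitude hΨ ha has (s + t))) x := by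
  rw [multiplierOp_eq_oscIntegral, FourierTransform.fourier_fourierInv_eq,
    fourierInv_modulatedAmplitude_apply]
  unfold oscIntegral
  congr with ξ
  by_cases hξ : a ξ = 0
  · simp [modulatedAmplitude_apply, hξ]
  · simp only [modulatedAmplitude_apply, hΦΨ ξ hξ, ← mul_assoc, ← Complex.exp_add]
    congr 2
    push_cast
    ring

end ModulatedAmplitude

theorem exists_contDiff_eqOn_closedBall {E : Type*} [NormedAddCommGroup E] [NormedSpace ℝ E]
    [HasContDiffBump E] {Φ : E → ℝ} (hΦ : ContDiffOn ℝ ∞ Φ {0}ᶜ) {ξ₀ : E} (hξ₀ : ξ₀ ≠ 0) :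
    ∃ Ψ : E → ℝ, ContDiff ℝ ∞ Ψ ∧ ∃ r > 0, r < ‖ξ₀‖ ∧ EqOn Ψ Φ (Metric.closedBall ξ₀ r) := by
  have hpos : 0 < ‖ξ₀‖ := norm_pos_iff.2 hξ₀
  let χ : ContDiffBump ξ₀ := ⟨‖ξ₀‖ / 4, ‖ξ₀‖ / 2, by positivity, by linarith⟩
  refine ⟨fun ξ => χ ξ * Φ ξ, contDiff_iff_contDiffAt.2 fun ξ => ?_, ‖ξ₀‖ / 4, by positivity,
    by linarith, fun ξ hξ => ?_⟩
  · rcases eq_or_ne ξ 0 with rfl | hξ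
    · have hzero : (fun ξ => χ ξ * Φ ξ) =ᶠ[𝓝 0] fun _ => 0 := by
        filter_upwards [Metric.ball_mem_nhds (0 : E) (half_pos hpos)] with y hy
        have hdist := dist_triangle_left (0 : E) ξ₀ y
        rw [Metric.mem_ball] at hy
        rw [dist_zero_left] at hdist
        have hrOut : χ.rOut ≤ dist y ξ₀ := by change ‖ξ₀‖ / 2 ≤ dist y ξ₀; linarith
        rw [χ.zero_of_le_dist hrOut, zero_mul]
      exact contDiffAt_const.congr_of_eventuallyEq hzero
    · exact χ.contDiffAt.mul (hΦ.contDiffAt (isOpen_compl_singleton.mem_nhds hξ))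
  · simp only
    rw [χ.one_of_mem_closedBall hξ, one_mul]

theorem exists_contDiff_amplitude {E : Type*} [NormedAddCommGroup E] [NormedSpace ℝ E]
    [HasContDiffBump E] (ξ₀ : E) {r : ℝ} (hr : 0 < r) :
    ∃ a : E → ℂ, ContDiff ℝ ∞ a ∧ a ξ₀ = 1 ∧ ∀ ξ ∉ Metric.closedBall ξ₀ r, a ξ = 0 := by
  let χ : ContDiffBump ξ₀ := ⟨r / 2, r, by positivity, by linarith⟩
  refine ⟨fun ξ => χ ξ, Complex.ofRealCLM.contDiff.comp χ.contDiff, ?_, fun ξ hξ => ?_⟩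
  · simp [χ.one_of_mem_closedBall (Metric.mem_closedBall_self χ.rIn_pos.le)]
  · rw [Metric.mem_closedBall, not_le] at hξ
    simp [χ.zero_of_le_dist hξ.le]

/-- An orbit of Schwartz functions under the group `t ↦ T_Φ^t` whose square `L²` norm is constantly
`A` while its supremum norm disperses at the rate `⟨s⟩^(-d/2)`. -/
structure IsDispersiveOrbit {d : ℕ} (Φ : Euc d → ℝ) (f : ℝ → 𝓢(Euc d, ℂ)) (A C : ℝ) : Prop where
  multiplierOp_apply : ∀ s t x, multiplierOp Φ t (f s) x = f (s + t) x
  integral_norm_sq : ∀ s, ∫ x, ‖f s x‖ ^ 2 = A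
  norm_apply_le : ∀ s x, ‖f s x‖ ≤ C * japanese s ^ (-(d : ℝ) / 2)

theorem exists_isDispersiveOrbit {d : ℕ} {Φ : Euc d → ℝ} (hΦ : IsSmoothZeroHomogeneous Φ)
    {ξ₀ : Euc d} (hξ₀ : ξ₀ ≠ 0) (hreg : HasRegularHessianAt Φ ξ₀) :
    ∃ f A C, 0 < A ∧ 0 < C ∧ IsDispersiveOrbit Φ f A C := by
  obtain ⟨Ψ, hΨ, r, hr, hrlt, hΨΦ⟩ := exists_contDiff_eqOn_closedBall hΦ.smooth hξ₀
  have hnt : Nontrivial (Euc d) := ⟨ξ₀, 0, hξ₀⟩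
  have hregΨ : HasRegularHessianAt Ψ ξ₀ := by
    have heq : Ψ =ᶠ[𝓝 ξ₀] Φ := hΨΦ.eventuallyEq_of_mem (Metric.closedBall_mem_nhds ξ₀ hr)
    rwa [HasRegularHessianAt, heq.fderiv.fderiv_eq]
  obtain ⟨δ, hδ, hdecay⟩ := exists_norm_oscIntegral_le_japanese_rpow hΨ hregΨ
  obtain ⟨a, ha, ha₁, ha₀⟩ := exists_contDiff_amplitude ξ₀ (lt_min hδ hr)
  have has : HasCompactSupport a := HasCompactSupport.intro (isCompact_closedBall ξ₀ _) ha₀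
  obtain ⟨C, hC⟩ := hdecay a ha fun ξ hξ =>
    ha₀ ξ fun h => hξ (Metric.closedBall_subset_closedBall (min_le_left _ _) h)
  have hA : 0 < ∫ ξ, ‖a ξ‖ ^ 2 := by
    refine (ha.continuous.norm.pow 2).integral_pos_of_hasCompactSupport_nonneg_nonzero
      (HasCompactSupport.intro (isCompact_closedBall ξ₀ (min δ r)) fun ξ hξ => by simp [ha₀ ξ hξ])
      (fun ξ => by positivity) (x := ξ₀) (by simp [ha₁])
  refine ⟨fun s => 𝓕⁻ (modulatedAmplitude hΨ ha has s), ∫ ξ, ‖a ξ‖ ^ 2, max C 1, hA,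
    lt_max_of_lt_right one_pos, ?_, integral_norm_sq_fourierInv_modulatedAmplitude hΨ ha has, ?_⟩
  · refine multiplierOp_fourierInv_modulatedAmplitude hΨ ha has fun ξ hξ => ?_
    have hξr : ξ ∈ Metric.closedBall ξ₀ r :=
      Metric.closedBall_subset_closedBall (min_le_right _ _) (by_contra fun h => hξ (ha₀ ξ h))
    have hξ0 : ξ ≠ 0 := by
      rintro rfl
      rw [Metric.mem_closedBall, dist_zero_left] at hξr
      linarith
    rw [hΦ.homogeneous _ (by positivity) ξ hξ0, hΨΦ hξr]
  · intro s x
    have hdecay := hC s ((2 * Real.pi) • x)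
    rw [finrank_euclideanSpace_fin] at hdecay
    have hj : 0 < japanese s := zero_lt_one.trans_le (one_le_japanese s)
    rw [fourierInv_modulatedAmplitude_apply]
    exact hdecay.trans (by gcongr; exact le_max_left C 1)

section LpGrowth

variable {d : ℕ}

theorem integrable_norm_rpow_schwartz (f : 𝓢(Euc d, ℂ)) {p : ℝ} (hp : 0 < p) :
    Integrable fun x => ‖f x‖ ^ p := by
  simpa only [ENNReal.toReal_ofReal hp.le] using
    (f.memLp (ENNReal.ofReal p) volume).integrable_norm_rpow (by simpa using hp)
      ENNReal.ofReal_ne_top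

theorem integral_norm_rpow_schwartz_pos {f : 𝓢(Euc d, ℂ)} (hf : f ≠ 0) {p : ℝ} (hp : 0 < p) :
    0 < ∫ x, ‖f x‖ ^ p := by
  obtain ⟨x, hx⟩ : ∃ x, f x ≠ 0 := by
    by_contra! h
    exact hf (SchwartzMap.ext h)
  exact integral_pos_of_integrable_nonneg_nonzero
    (f.continuous.norm.rpow_const fun _ => Or.inr hp.le) (integrable_norm_rpow_schwartz f hp)
    (fun x => by positivity) (x := x) (by positivity)

theorem integral_norm_rpow_schwartz_le {f : 𝓢(Euc d, ℂ)} {Q q r : ℝ} (hq : 0 < q) (hqr : q ≤ r)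
    (hQ : ∀ x, ‖f x‖ ≤ Q) : ∫ x, ‖f x‖ ^ r ≤ Q ^ (r - q) * ∫ x, ‖f x‖ ^ q := by
  rw [← integral_const_mul]
  refine integral_mono (integrable_norm_rpow_schwartz f (hq.trans_le hqr))
    ((integrable_norm_rpow_schwartz f hq).const_mul _) fun x => ?_
  calc ‖f x‖ ^ r = ‖f x‖ ^ (r - q) * ‖f x‖ ^ q := by
        rw [← Real.rpow_add_of_nonneg (norm_nonneg _) (sub_nonneg.2 hqr) hq.le, sub_add_cancel]
    _ ≤ Q ^ (r - q) * ‖f x‖ ^ q := by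
        have := sub_nonneg.2 hqr
        gcongr
        exact hQ x

theorem eLpNorm_schwartz_eq (f : 𝓢(Euc d, ℂ)) {p : ℝ} (hp : 0 < p) :
    eLpNorm (fun x => f x) (ENNReal.ofReal p) volume =
      ENNReal.ofReal ((∫ x, ‖f x‖ ^ p) ^ (1 / p)) := by
  rw [(f.memLp (ENNReal.ofReal p) volume).eLpNorm_eq_integral_rpow_norm
    (by simpa using hp) ENNReal.ofReal_ne_top, ENNReal.toReal_ofReal hp.le, one_div]

variable {Φ : Euc d → ℝ} {t p : ℝ}

theorem le_multiplierNorm (hp : 0 < p) {f g : 𝓢(Euc d, ℂ)} (hf : f ≠ 0)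
    (hfg : ∀ x, multiplierOp Φ t f x = g x) :
    ENNReal.ofReal ((∫ x, ‖g x‖ ^ p) ^ (1 / p) / (∫ x, ‖f x‖ ^ p) ^ (1 / p)) ≤
      multiplierNorm Φ t p := by
  have hpos := integral_norm_rpow_schwartz_pos hf hp
  rw [ENNReal.ofReal_div_of_pos (by positivity), ← eLpNorm_schwartz_eq f hp,
    ← eLpNorm_schwartz_eq g hp, ← funext hfg]
  exact le_iSup₂ (f := fun (f : 𝓢(Euc d, ℂ)) (_ : f ≠ 0) =>
    eLpNorm (multiplierOp Φ t f) (ENNReal.ofReal p) volume /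
      eLpNorm (fun x => f x) (ENNReal.ofReal p) volume) f hf

theorem rpow_one_div_dispersive {A C j : ℝ} (hA : 0 ≤ A) (hC : 0 ≤ C) (hj : 0 ≤ j) (hp : p ≠ 0) :
    ((C * j ^ (-(d : ℝ) / 2)) ^ (p - 2) * A) ^ (1 / p) =
      (C ^ (1 - 2 / p) * A ^ (1 / p)) * j ^ ((d : ℝ) * (1 / p - 1 / 2)) := by
  rw [Real.mul_rpow (by positivity) hA, ← Real.rpow_mul (by positivity),
    Real.mul_rpow hC (by positivity), ← Real.rpow_mul hj, mul_right_comm]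
  have hexp : (p - 2) * (1 / p) = 1 - 2 / p := by field_simp
  have hexp' : -(d : ℝ) / 2 * ((p - 2) * (1 / p)) = d * (1 / p - 1 / 2) := by
    field_simp
    ring
  rw [hexp', hexp]

namespace IsDispersiveOrbit

variable {f : ℝ → 𝓢(Euc d, ℂ)} {A C : ℝ}

theorem ne_zero (h : IsDispersiveOrbit Φ f A C) (hA : 0 < A) (s : ℝ) : f s ≠ 0 := by
  intro hs
  simpa [hs, hA.ne] using h.integral_norm_sq s

theorem integral_norm_rpow_two (h : IsDispersiveOrbit Φ f A C) (s : ℝ) :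
    ∫ x, ‖f s x‖ ^ (2 : ℝ) = A := by
  simp_rw [Real.rpow_two]
  exact h.integral_norm_sq s

theorem integral_rpow_le (h : IsDispersiveOrbit Φ f A C) (hA : 0 < A) (hC : 0 < C) (hp : 2 ≤ p)
    (s : ℝ) : (∫ x, ‖f s x‖ ^ p) ^ (1 / p) ≤
      (C ^ (1 - 2 / p) * A ^ (1 / p)) * japanese s ^ ((d : ℝ) * (1 / p - 1 / 2)) := by
  have hle := integral_norm_rpow_schwartz_le two_pos hp (h.norm_apply_le s)
  rw [h.integral_norm_rpow_two] at hle
  rw [← rpow_one_div_dispersive hA.le hC.le (zero_le_one.trans (one_le_japanese s)) (by positivity)]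
  gcongr

theorem le_integral_rpow (h : IsDispersiveOrbit Φ f A C) (hA : 0 < A) (hC : 0 < C) (hp : 0 < p)
    (hp₂ : p ≤ 2) (s : ℝ) : (C ^ (1 - 2 / p) * A ^ (1 / p)) *
      japanese s ^ ((d : ℝ) * (1 / p - 1 / 2)) ≤ (∫ x, ‖f s x‖ ^ p) ^ (1 / p) := by
  have hj : 0 < japanese s := zero_lt_one.trans_le (one_le_japanese s)
  have hle := integral_norm_rpow_schwartz_le hp hp₂ (h.norm_apply_le s)
  rw [h.integral_norm_rpow_two, ← neg_sub, Real.rpow_neg (by positivity),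
    ← div_eq_inv_mul, le_div_iff₀ (by positivity), mul_comm] at hle
  rw [← rpow_one_div_dispersive hA.le hC.le hj.le hp.ne']
  gcongr

theorem exists_le_multiplierNorm (h : IsDispersiveOrbit Φ f A C) (hA : 0 < A) (hC : 0 < C)
    (hp : 0 < p) : ∃ c : ℝ, 0 < c ∧ ∀ t : ℝ,
      ENNReal.ofReal (c * japanese t ^ ((d : ℝ) * |1 / 2 - 1 / p|)) ≤ multiplierNorm Φ t p := by
  set D := C ^ (1 - 2 / p) * A ^ (1 / p)
  have hD : 0 < D := by positivity
  have hpos (s : ℝ) : 0 < ∫ x, ‖f s x‖ ^ p := integral_norm_rpow_schwartz_pos (h.ne_zero hA s) hp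
  have hpos₀ := hpos 0
  rcases le_total p 2 with hp₂ | hp₂
  · refine ⟨D / (∫ x, ‖f 0 x‖ ^ p) ^ (1 / p), div_pos hD (by positivity), fun t => ?_⟩
    refine le_trans (ENNReal.ofReal_le_ofReal ?_) (le_multiplierNorm hp (h.ne_zero hA 0)
      (g := f t) fun x => by rw [h.multiplierOp_apply, zero_add])
    rw [abs_sub_comm, abs_of_nonneg (sub_nonneg.2 (one_div_le_one_div_of_le hp hp₂)),
      div_mul_eq_mul_div]
    gcongr
    exact h.le_integral_rpow hA hC hp hp₂ t
  · refine ⟨(∫ x, ‖f 0 x‖ ^ p) ^ (1 / p) / D, by positivity, fun t => ?_⟩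
    refine le_trans (ENNReal.ofReal_le_ofReal ?_) (le_multiplierNorm hp (h.ne_zero hA (-t))
      (g := f 0) fun x => by rw [h.multiplierOp_apply, neg_add_cancel])
    have hj : 0 < japanese t := zero_lt_one.trans_le (one_le_japanese t)
    have hpost := hpos (-t)
    have hle := h.integral_rpow_le hA hC hp₂ (-t)
    rw [show japanese (-t) = japanese t by simp [japanese]] at hle
    rw [abs_of_nonneg (sub_nonneg.2 (one_div_le_one_div_of_le two_pos hp₂)), ← neg_sub, mul_neg,
      Real.rpow_neg hj.le, ← div_eq_mul_inv, div_div]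
    gcongr

end IsDispersiveOrbit

end LpGrowth

theorem exists_le_multiplierNorm_of_hasRegularHessianAt {d : ℕ} {Φ : Euc d → ℝ}
    (hΦ : IsSmoothZeroHomogeneous Φ) {ξ₀ : Euc d} (hξ₀ : ξ₀ ≠ 0)
    (hreg : HasRegularHessianAt Φ ξ₀) {p : ℝ} (hp : 0 < p) :
    ∃ c : ℝ, 0 < c ∧ ∀ t : ℝ,
      ENNReal.ofReal (c * japanese t ^ ((d : ℝ) * |1 / 2 - 1 / p|)) ≤ multiplierNorm Φ t p := by
  obtain ⟨f, A, C, hA, hC, horbit⟩ := exists_isDispersiveOrbit hΦ hξ₀ hreg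
  exact horbit.exists_le_multiplierNorm hA hC hp

namespace IsSmoothZeroHomogeneous

variable {d : ℕ} {Φ : Euc d → ℝ} {ξ : Euc d}

theorem contDiffAt (hΦ : IsSmoothZeroHomogeneous Φ) (hξ : ξ ≠ 0) : ContDiffAt ℝ ∞ Φ ξ :=
  hΦ.smooth.contDiffAt (isOpen_compl_singleton.mem_nhds hξ)

theorem contDiffAt_fderiv (hΦ : IsSmoothZeroHomogeneous Φ) (hξ : ξ ≠ 0) :
    ContDiffAt ℝ ∞ (fderiv ℝ Φ) ξ :=
  (hΦ.contDiffAt hξ).fderiv_right (by simp)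

theorem fderiv_fderiv_comm (hΦ : IsSmoothZeroHomogeneous Φ) (hξ : ξ ≠ 0) (v w : Euc d) :
    fderiv ℝ (fderiv ℝ Φ) ξ v w = fderiv ℝ (fderiv ℝ Φ) ξ w v :=
  (hΦ.contDiffAt hξ).isSymmSndFDerivAt
    (minSmoothness_of_isRCLikeNormedField.trans_le ENat.LEInfty.out) v w

theorem fderiv_apply_self (hΦ : IsSmoothZeroHomogeneous Φ) (hξ : ξ ≠ 0) :
    fderiv ℝ Φ ξ ξ = 0 := by
  have hray : HasDerivAt (fun r : ℝ => r • ξ) ξ 1 := by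
    simpa using (hasDerivAt_id (1 : ℝ)).smul_const ξ
  have hΦξ : HasFDerivAt Φ (fderiv ℝ Φ ξ) ((1 : ℝ) • ξ) := by
    rw [one_smul]
    exact ((hΦ.contDiffAt hξ).differentiableAt (by simp)).hasFDerivAt
  have hconst : HasDerivAt (fun r : ℝ => Φ (r • ξ)) 0 1 := by
    refine (hasDerivAt_const (1 : ℝ) (Φ ξ)).congr_of_eventuallyEq ?_
    filter_upwards [Ioi_mem_nhds (zero_lt_one' ℝ)] with r hr
    exact hΦ.homogeneous r hr ξ hξ
  exact (hΦξ.comp_hasDerivAt (1 : ℝ) hray).unique hconst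

theorem fderiv_fderiv_apply_self (hΦ : IsSmoothZeroHomogeneous Φ) (hξ : ξ ≠ 0) (z : Euc d) :
    fderiv ℝ (fderiv ℝ Φ) ξ z ξ = -fderiv ℝ Φ ξ z := by
  have hprod := ((hΦ.contDiffAt_fderiv hξ).differentiableAt (by simp)).hasFDerivAt.clm_apply
    (hasFDerivAt_id ξ)
  have hzero : HasFDerivAt (fun η => fderiv ℝ Φ η η) (0 : Euc d →L[ℝ] ℝ) ξ := by
    refine (hasFDerivAt_const (0 : ℝ) ξ).congr_of_eventuallyEq ?_
    filter_upwards [isOpen_compl_singleton.mem_nhds hξ] with η hη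
    exact hΦ.fderiv_apply_self hη
  have hsum : fderiv ℝ Φ ξ z + fderiv ℝ (fderiv ℝ Φ) ξ z ξ = 0 := by
    simpa using congrArg (fun L => L z) (hprod.unique hzero)
  linarith

theorem fderiv_fderiv_self (hΦ : IsSmoothZeroHomogeneous Φ) (hξ : ξ ≠ 0) :
    fderiv ℝ (fderiv ℝ Φ) ξ ξ = -fderiv ℝ Φ ξ := by
  ext z
  rw [hΦ.fderiv_fderiv_comm hξ, hΦ.fderiv_fderiv_apply_self hξ, neg_apply]

theorem exists_fderiv_ne_zero (hΦ : IsSmoothZeroHomogeneous Φ) (hd : 1 < d)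
    (hnc : ¬ ∃ a : ℝ, ∀ ξ : Euc d, ξ ≠ 0 → Φ ξ = a) : ∃ ξ : Euc d, ξ ≠ 0 ∧ fderiv ℝ Φ ξ ≠ 0 := by
  by_contra! hzero
  have hrank : 1 < Module.rank ℝ (Euc d) := by
    rw [← Module.finrank_eq_rank, finrank_euclideanSpace_fin]
    exact_mod_cast hd
  obtain ⟨a, ha⟩ := isOpen_compl_singleton.exists_is_const_of_fderiv_eq_zero
    (isConnected_compl_singleton_of_one_lt_rank hrank 0).isPreconnected
    (hΦ.smooth.differentiableOn (by simp)) hzero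
  exact hnc ⟨a, ha⟩

theorem hasRegularHessianAt_of_fderiv_ne_zero {Φ : Euc 2 → ℝ} (hΦ : IsSmoothZeroHomogeneous Φ)
    {ξ : Euc 2} (hξ : ξ ≠ 0) (hd : fderiv ℝ Φ ξ ≠ 0) : HasRegularHessianAt Φ ξ := by
  intro w hw
  have hw₁ : fderiv ℝ Φ ξ w = 0 := by
    rw [← neg_eq_zero, ← hΦ.fderiv_fderiv_apply_self hξ, hw, zero_apply]
  have hker : Module.finrank ℝ (fderiv ℝ Φ ξ).ker = 1 := by
    have hadd := Module.Dual.finrank_ker_add_one_of_ne_zero (K := ℝ)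
      (f := (fderiv ℝ Φ ξ).toLinearMap) fun h => hd (ContinuousLinearMap.coe_injective h)
    rw [finrank_euclideanSpace_fin] at hadd
    omega
  have hξker : (⟨ξ, hΦ.fderiv_apply_self hξ⟩ : (fderiv ℝ Φ ξ).ker) ≠ 0 :=
    fun h => hξ (congrArg Subtype.val h)
  obtain ⟨c, hc⟩ := (finrank_eq_one_iff_of_nonzero' _ hξker).1 hker ⟨w, hw₁⟩
  have hcξ : c • ξ = w := congrArg Subtype.val hc
  rw [← hcξ, map_smul, hΦ.fderiv_fderiv_self hξ, smul_neg, neg_eq_zero] at hw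
  rw [← hcξ, (smul_eq_zero.1 hw).resolve_right hd, zero_smul]

end IsSmoothZeroHomogeneous

/-- The Hessian of `Φ` at `p` is injective on the orthogonal complement of `p`: the nondegeneracy
available at a critical point of a `0`-homogeneous function, whose Hessian annihilates `p`. -/
def HasTangentiallyRegularHessianAt {d : ℕ} (Φ : Euc d → ℝ) (p : Euc d) : Prop :=
  ∀ z, inner ℝ p z = 0 → fderiv ℝ (fderiv ℝ Φ) p z = 0 → z = 0

/-- The Hessian of `Φ` at `ξ` plus the square of the linear form `⟪p, ·⟫`. It is regular for `ξ`
near a nondegenerate critical direction `p`, where the Hessian itself need not be. -/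
def augmentedHessian {d : ℕ} (Φ : Euc d → ℝ) (p ξ : Euc d) : Euc d →L[ℝ] Euc d →L[ℝ] ℝ :=
  fderiv ℝ (fderiv ℝ Φ) ξ + (innerSL ℝ p).smulRight (innerSL ℝ p)

section AugmentedHessian

variable {d : ℕ} {Φ : Euc d → ℝ} {p ξ : Euc d}

theorem augmentedHessian_apply (z : Euc d) :
    augmentedHessian Φ p ξ z = fderiv ℝ (fderiv ℝ Φ) ξ z + inner ℝ p z • innerSL ℝ p :=
  rfl

-- The radial direction isolates `fderiv ℝ Φ ξ` as the off-diagonal block of the Hessian; the last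
-- hypothesis says that the corresponding Schur complement does not vanish.
theorem hasRegularHessianAt_of_augmentedHessian (hΦ : IsSmoothZeroHomogeneous Φ) (hξ : ξ ≠ 0)
    (hinv : (augmentedHessian Φ p ξ).IsInvertible)
    (hschur : fderiv ℝ Φ ξ ((augmentedHessian Φ p ξ).inverse (fderiv ℝ Φ ξ)) ≠ 0) :
    HasRegularHessianAt Φ ξ := by
  intro w hw
  have hinj := hinv.injective
  have hw₁ : fderiv ℝ Φ ξ w = 0 := by
    rw [← neg_eq_zero, ← hΦ.fderiv_fderiv_apply_self hξ, hw, zero_apply]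
  have hcomb : (inner ℝ p ξ : ℝ) • w - (inner ℝ p w : ℝ) • ξ =
      (inner ℝ p w : ℝ) • (augmentedHessian Φ p ξ).inverse (fderiv ℝ Φ ξ) := by
    apply hinj
    rw [map_smul _ (inner ℝ p w : ℝ), hinv.self_apply_inverse, map_sub, map_smul, map_smul,
      augmentedHessian_apply, augmentedHessian_apply, hw, hΦ.fderiv_fderiv_self hξ]
    module
  have hpw : (inner ℝ p w : ℝ) = 0 := by
    have happ := congrArg (fderiv ℝ Φ ξ) hcomb
    rw [map_sub, map_smul, map_smul, map_smul, hw₁, hΦ.fderiv_apply_self hξ, smul_zero, smul_zero,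
      sub_zero, eq_comm, smul_eq_zero] at happ
    exact happ.resolve_right hschur
  apply hinj
  rw [augmentedHessian_apply, hw, hpw, zero_smul, zero_add, map_zero]

theorem isInvertible_augmentedHessian (hΦ : IsSmoothZeroHomogeneous Φ) (hp : p ≠ 0)
    (hcrit : fderiv ℝ Φ p = 0) (hreg : HasTangentiallyRegularHessianAt Φ p) :
    (augmentedHessian Φ p p).IsInvertible := by
  have hinj : Function.Injective (augmentedHessian Φ p p) := by
    rw [injective_iff_map_eq_zero]
    intro z hz
    rw [augmentedHessian_apply] at hz
    have hpz : (inner ℝ p z : ℝ) = 0 := by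
      simpa [hΦ.fderiv_fderiv_apply_self hp, hcrit, hp] using congrArg (fun L => L p) hz
    exact hreg z hpz (by simpa [hpz] using hz)
  have hfin : Module.finrank ℝ (Euc d) = Module.finrank ℝ (Euc d →L[ℝ] ℝ) :=
    (InnerProductSpace.toDual ℝ (Euc d)).toLinearEquiv.finrank_eq
  exact ⟨(LinearEquiv.ofInjectiveOfFinrankEq
    (augmentedHessian Φ p p).toLinearMap hinj hfin).toContinuousLinearEquiv, rfl⟩

theorem exists_fderiv_fderiv_apply_apply_ne_zero (hΦ : IsSmoothZeroHomogeneous Φ) (hp : p ≠ 0)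
    (hreg : HasTangentiallyRegularHessianAt Φ p) (hd : 1 < d) :
    ∃ u, fderiv ℝ (fderiv ℝ Φ) p u u ≠ 0 := by
  by_contra! hzero
  have : Nontrivial (ℝ ∙ p)ᗮ := by
    rw [← Module.finrank_pos_iff (R := ℝ)]
    have := (ℝ ∙ p).finrank_add_finrank_orthogonal
    rw [finrank_span_singleton hp, finrank_euclideanSpace_fin] at this
    omega
  obtain ⟨⟨z, hz⟩, hz₀⟩ := exists_ne (0 : (ℝ ∙ p)ᗮ)
  refine hz₀ (Subtype.ext (hreg z (Submodule.mem_orthogonal_singleton_iff_inner_right.1 hz) ?_))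
  ext w
  have hpolar := hzero (z + w)
  simp only [map_add, add_apply, hzero z, hzero w, hΦ.fderiv_fderiv_comm hp w z] at hpolar
  rw [zero_apply]
  linarith

theorem inverse_augmentedHessian_fderiv_fderiv (hΦ : IsSmoothZeroHomogeneous Φ) (hp : p ≠ 0)
    (hcrit : fderiv ℝ Φ p = 0) (hinv : (augmentedHessian Φ p p).IsInvertible) (u : Euc d) :
    (augmentedHessian Φ p p).inverse (fderiv ℝ (fderiv ℝ Φ) p u) =
      u - ((inner ℝ p u : ℝ) / ‖p‖ ^ 2) • p := by
  rw [hinv.inverse_apply_eq, augmentedHessian_apply, map_sub, map_smul, hΦ.fderiv_fderiv_self hp,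
    hcrit, inner_sub_right, inner_smul_right, real_inner_self_eq_norm_sq,
    div_mul_cancel₀ _ (pow_ne_zero 2 (norm_ne_zero_iff.2 hp))]
  simp

theorem exists_hasRegularHessianAt_of_fderiv_eq_zero (hΦ : IsSmoothZeroHomogeneous Φ) (hd : 1 < d)
    (hp : p ≠ 0) (hcrit : fderiv ℝ Φ p = 0) (hreg : HasTangentiallyRegularHessianAt Φ p) :
    ∃ ξ, ξ ≠ 0 ∧ HasRegularHessianAt Φ ξ := by
  obtain ⟨u, hu⟩ := exists_fderiv_fderiv_apply_apply_ne_zero hΦ hp hreg hd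
  have hinv := isInvertible_augmentedHessian hΦ hp hcrit hreg
  have hline : HasDerivAt (fun ε : ℝ => p + ε • u) u 0 := by
    simpa using ((hasDerivAt_id (0 : ℝ)).smul_const u).const_add p
  have hlim : Tendsto (fun ε : ℝ => p + ε • u) (𝓝[≠] 0) (𝓝 p) := by
    simpa using hline.continuousAt.tendsto.mono_left nhdsWithin_le_nhds
  have hslope : Tendsto (fun ε : ℝ => ε⁻¹ • fderiv ℝ Φ (p + ε • u)) (𝓝[≠] 0)
      (𝓝 (fderiv ℝ (fderiv ℝ Φ) p u)) := by
    have hderiv : HasFDerivAt (fderiv ℝ Φ) (fderiv ℝ (fderiv ℝ Φ) p) (p + (0 : ℝ) • u) := by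
      rw [zero_smul, add_zero]
      exact ((hΦ.contDiffAt_fderiv hp).differentiableAt (by simp)).hasFDerivAt
    simpa [hcrit] using hasDerivAt_iff_tendsto_slope_zero.1 (hderiv.comp_hasDerivAt (0 : ℝ) hline)
  have haug : Tendsto (fun ε : ℝ => augmentedHessian Φ p (p + ε • u)) (𝓝[≠] 0)
      (𝓝 (augmentedHessian Φ p p)) :=
    (((hΦ.contDiffAt_fderiv hp).fderiv_right (m := 0) (by simp)).continuousAt.tendsto.comp
      hlim).add_const _
  have hinverse : Tendsto (fun ε : ℝ => (augmentedHessian Φ p (p + ε • u)).inverse) (𝓝[≠] 0)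
      (𝓝 (augmentedHessian Φ p p).inverse) :=
    (hinv.contDiffAt_map_inverse (n := 0)).continuousAt.tendsto.comp haug
  have hnhds : ∀ᶠ L in 𝓝 (augmentedHessian Φ p p), L.IsInvertible := by
    obtain ⟨e, he⟩ := hinv
    exact he ▸ e.nhds
  have hsolve := (isBoundedBilinearMap_apply.continuous.tendsto _).comp
    (hinverse.prodMk_nhds hslope)
  have hschur := (isBoundedBilinearMap_apply.continuous.tendsto _).comp
    (hslope.prodMk_nhds hsolve)
  simp only [Function.comp_def] at hschur
  rw [inverse_augmentedHessian_fderiv_fderiv hΦ hp hcrit hinv, map_sub, map_smul,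
    hΦ.fderiv_fderiv_apply_self hp, hcrit, zero_apply, neg_zero, smul_zero, sub_zero] at hschur
  obtain ⟨ε, hschurε, hinvε, hε₀⟩ := ((hschur.eventually_ne hu).and
    ((haug.eventually hnhds).and (hlim.eventually_ne hp))).exists
  refine ⟨p + ε • u, hε₀, hasRegularHessianAt_of_augmentedHessian hΦ hε₀ hinvε fun h => hschurε ?_⟩
  rw [map_smul, smul_apply, map_smul, h, smul_zero, smul_zero]

end AugmentedHessian

theorem fderiv_fderiv_comp_of_fderiv_eq_zero {V W : Type*} [NormedAddCommGroup V]
    [NormedSpace ℝ V] [NormedAddCommGroup W] [NormedSpace ℝ W] {h : W → ℝ} {τ : V → W} {x : V}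
    (hh : ContDiffAt ℝ 2 h (τ x)) (hτ : ContDiffAt ℝ 2 τ x) (hcrit : fderiv ℝ h (τ x) = 0)
    (v w : V) : fderiv ℝ (fderiv ℝ (h ∘ τ)) x v w =
      fderiv ℝ (fderiv ℝ h) (τ x) (fderiv ℝ τ x v) (fderiv ℝ τ x w) := by
  have hchain : fderiv ℝ (h ∘ τ) =ᶠ[𝓝 x] fun y => (fderiv ℝ h (τ y)).comp (fderiv ℝ τ y) := by
    filter_upwards [hτ.eventually (by simp), hτ.continuousAt.eventually (hh.eventually (by simp))]
      with y hτy hhy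
    exact fderiv_comp y (hhy.differentiableAt (by simp)) (hτy.differentiableAt (by simp))
  have hh₂ := ((hh.fderiv_right (m := 1) (by norm_num)).differentiableAt (by simp)).hasFDerivAt
  have hτ₂ := ((hτ.fderiv_right (m := 1) (by norm_num)).differentiableAt (by simp)).hasFDerivAt
  have hτ₁ := (hτ.differentiableAt (by simp)).hasFDerivAt
  have hderiv := (hh₂.comp x hτ₁).clm_comp hτ₂
  simp only [Function.comp_apply] at hderiv
  rw [hchain.fderiv_eq, hderiv.fderiv]
  simp [hcrit]

theorem isUnit_hessian_iff {n : ℕ} (h : Euc n → ℝ) (x : Euc n) :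
    IsUnit (hessian h x) ↔ HasRegularHessianAt h x := by
  let b := (EuclideanSpace.basisFun (Fin n) ℝ).toBasis
  let B := (fderiv ℝ (fderiv ℝ h) x).toLinearMap₁₂
  have hB : hessian h x = LinearMap.toMatrix₂ b b B := by
    ext j k
    simp [hessian, LinearMap.toMatrix₂_apply, b, B]
  rw [hB, Matrix.isUnit_iff_isUnit_det, isUnit_iff_ne_zero,
    ← LinearMap.separatingLeft_iff_det_ne_zero]
  exact forall_congr' fun w => imp_congr_left
    (ContinuousLinearMap.ext_iff (f := fderiv ℝ (fderiv ℝ h) x w) (g := 0)).symm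

section Normalize

variable {E : Type*} [NormedAddCommGroup E] [InnerProductSpace ℝ E] {ξ : E}

theorem hasFDerivAt_norm (hξ : ξ ≠ 0) :
    HasFDerivAt (fun η : E => ‖η‖) (‖ξ‖⁻¹ • innerSL ℝ ξ) ξ := by
  have hsqrt := (hasFDerivAt_id ξ).norm_sq.sqrt (by simpa using hξ)
  simp only [id, Real.sqrt_sq (norm_nonneg _)] at hsqrt
  refine hsqrt.congr_fderiv ?_
  ext z
  simp
  field_simp

theorem hasFDerivAt_normalize (hξ : ξ ≠ 0) :
    HasFDerivAt (fun η : E => ‖η‖⁻¹ • η) (‖ξ‖⁻¹ • ContinuousLinearMap.id ℝ E -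
        (‖ξ‖⁻¹ ^ 3 • innerSL ℝ ξ).smulRight ξ) ξ := by
  have hprod := ((hasDerivAt_inv (norm_ne_zero_iff.2 hξ)).comp_hasFDerivAt ξ
    (hasFDerivAt_norm hξ)).smul (hasFDerivAt_id ξ)
  refine hprod.congr_fderiv ?_
  ext z
  simp
  module

theorem contDiffAt_normalize (hξ : ξ ≠ 0) : ContDiffAt ℝ ∞ (fun η : E => ‖η‖⁻¹ • η) ξ :=
  ((contDiffAt_norm ℝ hξ).inv (norm_ne_zero_iff.2 hξ)).smul contDiffAt_id

end Normalize

section Sphere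

variable {n : ℕ}

theorem coe_sphere_ne_zero (p : Sph n) : (p : Euc (n + 1)) ≠ 0 :=
  ne_zero_of_mem_unit_sphere p

instance : Nonempty (Sph n) :=
  ⟨⟨EuclideanSpace.single 0 1, by simp⟩⟩

/-- The radial projection `ξ ↦ ξ / |ξ|` onto the sphere, with an arbitrary value at the origin. -/
def radial (ξ : Euc (n + 1)) : Sph n :=
  open Classical in
  if h : ξ ≠ 0 then ⟨‖ξ‖⁻¹ • ξ, by simp [norm_smul, norm_ne_zero_iff.mpr h]⟩
  else Classical.arbitrary _

theorem coe_radial {ξ : Euc (n + 1)} (hξ : ξ ≠ 0) : (radial ξ : Euc (n + 1)) = ‖ξ‖⁻¹ • ξ := by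
  simp [radial, hξ]

theorem radial_coe (p : Sph n) : radial (p : Euc (n + 1)) = p := by
  ext1
  rw [coe_radial (coe_sphere_ne_zero p), norm_eq_of_mem_sphere, inv_one, one_smul]

theorem homogeneousExtension_eq (φ : Sph n → ℝ) {ξ : Euc (n + 1)} (hξ : ξ ≠ 0) :
    homogeneousExtension φ ξ = φ (radial ξ) := by
  simp [homogeneousExtension, radial, hξ]

theorem homogeneousExtension_coe (φ : Sph n → ℝ) (p : Sph n) :
    homogeneousExtension φ (p : Euc (n + 1)) = φ p := by
  rw [homogeneousExtension_eq φ (coe_sphere_ne_zero p), radial_coe]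

theorem contMDiffAt_radial {ξ : Euc (n + 1)} (hξ : ξ ≠ 0) :
    ContMDiffAt 𝓘(ℝ, Euc (n + 1)) (𝓡 n) ∞ (radial (n := n)) ξ := by
  have := Fact.mk (@finrank_euclideanSpace_fin ℝ _ (n + 1))
  let U : TopologicalSpace.Opens (Euc (n + 1)) := ⟨{0}ᶜ, isOpen_compl_singleton⟩
  have hnormalize : ContMDiff 𝓘(ℝ, Euc (n + 1)) 𝓘(ℝ, Euc (n + 1)) ∞
      (fun x : U => ‖(x : Euc (n + 1))‖⁻¹ • (x : Euc (n + 1))) := fun x =>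
    (contMDiffAt_subtype_iff (f := fun η : Euc (n + 1) => ‖η‖⁻¹ • η)).2
      (contDiffAt_normalize x.2).contMDiffAt
  refine (contMDiffAt_subtype_iff (U := U) (f := radial (n := n)) (x := ⟨ξ, hξ⟩)).1 ?_
  convert! hnormalize.codRestrict_sphere (n := n) (fun x => ?_) ⟨ξ, hξ⟩ using 1
  · ext1 x
    exact Subtype.ext (coe_radial x.2)
  · have hx : ‖(x : Euc (n + 1))‖ ≠ 0 := norm_ne_zero_iff.2 x.2
    simp [norm_smul, hx]

theorem isSmoothZeroHomogeneous_homogeneousExtension (φ : C^∞⟮𝓡 n, Sph n; ℝ⟯) :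
    IsSmoothZeroHomogeneous (homogeneousExtension φ) where
  smooth ξ hξ := by
    have hφ : ContMDiffAt 𝓘(ℝ, Euc (n + 1)) 𝓘(ℝ, ℝ) ∞ (φ ∘ radial (n := n)) ξ :=
      (φ.contMDiff (radial ξ)).comp ξ (contMDiffAt_radial hξ)
    have heq : homogeneousExtension φ =ᶠ[𝓝 ξ] φ ∘ radial (n := n) := by
      filter_upwards [isOpen_compl_singleton.mem_nhds hξ] with η hη
      exact homogeneousExtension_eq φ hη
    exact (hφ.contDiffAt.congr_of_eventuallyEq heq).contDiffWithinAt
  homogeneous r hr ξ hξ := by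
    have hrξ : r • ξ ≠ 0 := smul_ne_zero hr.ne' hξ
    rw [homogeneousExtension_eq φ hrξ, homogeneousExtension_eq φ hξ]
    congr 1
    ext1
    rw [coe_radial hrξ, coe_radial hξ, norm_smul, Real.norm_of_nonneg hr.le, smul_smul, mul_inv,
      mul_right_comm, inv_mul_cancel₀ hr.ne', one_mul]

variable {ψ : OpenPartialHomeomorph (Sph n) (Euc n)} {p : Sph n}

theorem contDiffAt_coe_symm (hψ : ψ ∈ IsManifold.maximalAtlas (𝓡 n) ∞ (Sph n)) {y : Euc n}
    (hy : y ∈ ψ.target) : ContDiffAt ℝ ∞ (fun y => (ψ.symm y : Euc (n + 1))) y := by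
  have := Fact.mk (@finrank_euclideanSpace_fin ℝ _ (n + 1))
  have hsymm : ContMDiffAt (𝓡 n) (𝓡 n) ∞ ψ.symm y :=
    (contMDiffOn_symm_of_mem_maximalAtlas hψ).contMDiffAt (ψ.open_target.mem_nhds hy)
  have hcoe : ContMDiffAt (𝓡 n) 𝓘(ℝ, Euc (n + 1)) ∞ ((↑) : Sph n → Euc (n + 1)) (ψ.symm y) :=
    contMDiff_coe_sphere _
  exact (hcoe.comp y hsymm).contDiffAt

theorem hasFDerivAt_coe_symm (hψ : ψ ∈ IsManifold.maximalAtlas (𝓡 n) ∞ (Sph n))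
    (hp : p ∈ ψ.source) : HasFDerivAt (fun y => (ψ.symm y : Euc (n + 1)))
      (fderiv ℝ (fun y => (ψ.symm y : Euc (n + 1))) (ψ p)) (ψ p) :=
  ((contDiffAt_coe_symm hψ (ψ.map_source hp)).differentiableAt (by simp)).hasFDerivAt

theorem contDiffAt_comp_radial (hψ : ψ ∈ IsManifold.maximalAtlas (𝓡 n) ∞ (Sph n))
    (hp : p ∈ ψ.source) : ContDiffAt ℝ ∞ (fun ξ => ψ (radial ξ)) (p : Euc (n + 1)) := by
  have hψp : ContMDiffAt (𝓡 n) (𝓡 n) ∞ ψ (radial (p : Euc (n + 1))) := by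
    rw [radial_coe]
    exact (contMDiffOn_of_mem_maximalAtlas hψ).contMDiffAt (ψ.open_source.mem_nhds hp)
  exact (hψp.comp _ (contMDiffAt_radial (coe_sphere_ne_zero p))).contDiffAt

theorem hasFDerivAt_comp_radial (hψ : ψ ∈ IsManifold.maximalAtlas (𝓡 n) ∞ (Sph n))
    (hp : p ∈ ψ.source) : HasFDerivAt (fun ξ => ψ (radial ξ))
      (fderiv ℝ (fun ξ => ψ (radial ξ)) (p : Euc (n + 1))) (p : Euc (n + 1)) :=
  ((contDiffAt_comp_radial hψ hp).differentiableAt (by simp)).hasFDerivAt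

theorem eventually_radial_mem_source (hp : p ∈ ψ.source) :
    ∀ᶠ ξ in 𝓝 (p : Euc (n + 1)), radial ξ ∈ ψ.source :=
  (contMDiffAt_radial (coe_sphere_ne_zero p)).continuousAt.eventually
    (by rw [radial_coe]; exact ψ.open_source.mem_nhds hp)

theorem comp_symm_eq_homogeneousExtension_comp (φ : Sph n → ℝ) :
    φ ∘ ψ.symm = homogeneousExtension φ ∘ fun y => (ψ.symm y : Euc (n + 1)) :=
  funext fun y => (homogeneousExtension_coe φ (ψ.symm y)).symm

theorem contDiffAt_comp_symm (hψ : ψ ∈ IsManifold.maximalAtlas (𝓡 n) ∞ (Sph n))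
    (φ : C^∞⟮𝓡 n, Sph n; ℝ⟯) {y : Euc n} (hy : y ∈ ψ.target) :
    ContDiffAt ℝ ∞ (φ ∘ ψ.symm) y := by
  rw [comp_symm_eq_homogeneousExtension_comp]
  exact ((isSmoothZeroHomogeneous_homogeneousExtension φ).contDiffAt
    (coe_sphere_ne_zero _)).comp y (contDiffAt_coe_symm hψ hy)

theorem homogeneousExtension_eventuallyEq (φ : Sph n → ℝ) (hp : p ∈ ψ.source) :
    homogeneousExtension φ =ᶠ[𝓝 (p : Euc (n + 1))] (φ ∘ ψ.symm) ∘ fun ξ => ψ (radial ξ) := by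
  filter_upwards [eventually_radial_mem_source hp,
    isOpen_compl_singleton.mem_nhds (coe_sphere_ne_zero p)] with ξ hξ hξ₀
  rw [homogeneousExtension_eq φ hξ₀, Function.comp_apply, Function.comp_apply, ψ.left_inv hξ]

theorem fderiv_comp_radial_fderiv_coe_symm (hψ : ψ ∈ IsManifold.maximalAtlas (𝓡 n) ∞ (Sph n))
    (hp : p ∈ ψ.source) (a : Euc n) :
    fderiv ℝ (fun ξ => ψ (radial ξ)) (p : Euc (n + 1))
      (fderiv ℝ (fun y => (ψ.symm y : Euc (n + 1))) (ψ p) a) = a := by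
  have houter : HasFDerivAt (fun ξ => ψ (radial ξ))
      (fderiv ℝ (fun ξ => ψ (radial ξ)) (p : Euc (n + 1))) (ψ.symm (ψ p) : Euc (n + 1)) := by
    rw [ψ.left_inv hp]
    exact hasFDerivAt_comp_radial hψ hp
  have hid : HasFDerivAt ((fun ξ => ψ (radial ξ)) ∘ fun y => (ψ.symm y : Euc (n + 1)))
      (ContinuousLinearMap.id ℝ (Euc n)) (ψ p) := by
    refine (hasFDerivAt_id (ψ p)).congr_of_eventuallyEq ?_
    filter_upwards [ψ.open_target.mem_nhds (ψ.map_source hp)] with y hy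
    simp [radial_coe, ψ.right_inv hy]
  exact congrArg (fun L => L a) ((houter.comp (ψ p) (hasFDerivAt_coe_symm hψ hp)).unique hid)

theorem fderiv_coe_symm_fderiv_comp_radial (hψ : ψ ∈ IsManifold.maximalAtlas (𝓡 n) ∞ (Sph n))
    (hp : p ∈ ψ.source) {z : Euc (n + 1)} (hz : inner ℝ (p : Euc (n + 1)) z = 0) :
    fderiv ℝ (fun y => (ψ.symm y : Euc (n + 1))) (ψ p)
      (fderiv ℝ (fun ξ => ψ (radial ξ)) (p : Euc (n + 1)) z) = z := by
  have houter : HasFDerivAt (fun y => (ψ.symm y : Euc (n + 1)))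
      (fderiv ℝ (fun y => (ψ.symm y : Euc (n + 1))) (ψ p)) (ψ (radial (p : Euc (n + 1)))) := by
    rw [radial_coe]
    exact hasFDerivAt_coe_symm hψ hp
  have hnormalize := (hasFDerivAt_normalize (coe_sphere_ne_zero p)).congr_of_eventuallyEq
    (f₁ := (fun y => (ψ.symm y : Euc (n + 1))) ∘ fun ξ => ψ (radial ξ)) (by
      filter_upwards [eventually_radial_mem_source hp,
        isOpen_compl_singleton.mem_nhds (coe_sphere_ne_zero p)] with ξ hξ hξ₀
      simp [ψ.left_inv hξ, coe_radial hξ₀])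
  simpa [hz] using congrArg (fun L => L z)
    ((houter.comp (p : Euc (n + 1)) (hasFDerivAt_comp_radial hψ hp)).unique hnormalize)

theorem inner_fderiv_coe_symm (hψ : ψ ∈ IsManifold.maximalAtlas (𝓡 n) ∞ (Sph n))
    (hp : p ∈ ψ.source) (a : Euc n) :
    inner ℝ (p : Euc (n + 1)) (fderiv ℝ (fun y => (ψ.symm y : Euc (n + 1))) (ψ p) a) = 0 := by
  have hconst : HasFDerivAt (fun y => ‖(ψ.symm y : Euc (n + 1))‖ ^ 2) (0 : Euc n →L[ℝ] ℝ)
      (ψ p) := by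
    simpa using hasFDerivAt_const (1 : ℝ) (ψ p)
  simpa [ψ.left_inv hp] using
    congrArg (fun L => L a) ((hasFDerivAt_coe_symm hψ hp).norm_sq.unique hconst)

theorem fderiv_comp_symm_eq_zero_iff (hψ : ψ ∈ IsManifold.maximalAtlas (𝓡 n) ∞ (Sph n))
    (φ : C^∞⟮𝓡 n, Sph n; ℝ⟯) (hp : p ∈ ψ.source) :
    fderiv ℝ (φ ∘ ψ.symm) (ψ p) = 0 ↔
      fderiv ℝ (homogeneousExtension φ) (p : Euc (n + 1)) = 0 := by
  constructor
  · intro h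
    have hdiff : DifferentiableAt ℝ (φ ∘ ψ.symm) (ψ (radial (p : Euc (n + 1)))) := by
      rw [radial_coe]
      exact (contDiffAt_comp_symm hψ φ (ψ.map_source hp)).differentiableAt (by simp)
    rw [(homogeneousExtension_eventuallyEq φ hp).fderiv_eq,
      fderiv_comp (p : Euc (n + 1)) (f := fun ξ => ψ (radial ξ)) hdiff
        (hasFDerivAt_comp_radial hψ hp).differentiableAt, radial_coe, h,
      ContinuousLinearMap.zero_comp]
  · intro h
    have hdiff := ((isSmoothZeroHomogeneous_homogeneousExtension φ).contDiffAt
      (coe_sphere_ne_zero (ψ.symm (ψ p)))).differentiableAt (by simp)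
    rw [comp_symm_eq_homogeneousExtension_comp,
      fderiv_comp (ψ p) (f := fun y => (ψ.symm y : Euc (n + 1))) hdiff
        (hasFDerivAt_coe_symm hψ hp).differentiableAt, ψ.left_inv hp, h,
      ContinuousLinearMap.zero_comp]

theorem fderiv_fderiv_homogeneousExtension (hψ : ψ ∈ IsManifold.maximalAtlas (𝓡 n) ∞ (Sph n))
    (φ : C^∞⟮𝓡 n, Sph n; ℝ⟯) (hp : p ∈ ψ.source)
    (hcrit : fderiv ℝ (homogeneousExtension φ) (p : Euc (n + 1)) = 0) (z w : Euc (n + 1)) :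
    fderiv ℝ (fderiv ℝ (homogeneousExtension φ)) (p : Euc (n + 1)) z w =
      fderiv ℝ (fderiv ℝ (φ ∘ ψ.symm)) (ψ p)
        (fderiv ℝ (fun ξ => ψ (radial ξ)) (p : Euc (n + 1)) z)
        (fderiv ℝ (fun ξ => ψ (radial ξ)) (p : Euc (n + 1)) w) := by
  have hψp : ψ (radial (p : Euc (n + 1))) = ψ p := by rw [radial_coe]
  rw [(homogeneousExtension_eventuallyEq φ hp).fderiv.fderiv_eq,
    fderiv_fderiv_comp_of_fderiv_eq_zero, hψp]
  · rw [hψp]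
    exact (contDiffAt_comp_symm hψ φ (ψ.map_source hp)).of_le ENat.LEInfty.out
  · exact (contDiffAt_comp_radial hψ hp).of_le ENat.LEInfty.out
  · rw [hψp]
    exact (fderiv_comp_symm_eq_zero_iff hψ φ hp).2 hcrit

theorem hasRegularHessianAt_comp_symm_iff (hψ : ψ ∈ IsManifold.maximalAtlas (𝓡 n) ∞ (Sph n))
    (φ : C^∞⟮𝓡 n, Sph n; ℝ⟯) (hp : p ∈ ψ.source)
    (hcrit : fderiv ℝ (homogeneousExtension φ) (p : Euc (n + 1)) = 0) :
    HasRegularHessianAt (φ ∘ ψ.symm) (ψ p) ↔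
      HasTangentiallyRegularHessianAt (homogeneousExtension φ) (p : Euc (n + 1)) := by
  have hD2 := fderiv_fderiv_homogeneousExtension hψ φ hp hcrit
  constructor
  · intro hreg z hz hDz
    have hzero : fderiv ℝ (fun ξ => ψ (radial ξ)) (p : Euc (n + 1)) z = 0 := by
      refine hreg _ (ContinuousLinearMap.ext fun b => ?_)
      rw [← fderiv_comp_radial_fderiv_coe_symm hψ hp b, ← hD2, hDz, zero_apply, zero_apply]
    rw [← fderiv_coe_symm_fderiv_comp_radial hψ hp hz, hzero, map_zero]
  · intro hreg a ha
    have htangent := fderiv_comp_radial_fderiv_coe_symm hψ hp a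
    rw [← htangent, hreg _ (inner_fderiv_coe_symm hψ hp a) ?_, map_zero]
    ext w
    rw [hD2, htangent, ha, zero_apply, zero_apply]

theorem mfderiv_eq_zero_iff (φ : C^∞⟮𝓡 n, Sph n; ℝ⟯) (p : Sph n) :
    mfderiv (𝓡 n) 𝓘(ℝ, ℝ) φ p = 0 ↔
      fderiv ℝ (homogeneousExtension φ) (p : Euc (n + 1)) = 0 := by
  rw [← fderiv_comp_symm_eq_zero_iff (IsManifold.chart_mem_maximalAtlas p) φ
    (mem_chart_source (Euc n) p), (φ.contMDiff.mdifferentiableAt (by simp)).mfderiv]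
  simp only [writtenInExtChartAt, extChartAt, mfld_simps, fderivWithin_univ]
  rfl

theorem isMorse_iff (φ : C^∞⟮𝓡 n, Sph n; ℝ⟯) :
    IsMorse φ ↔ ∀ p : Sph n, fderiv ℝ (homogeneousExtension φ) (p : Euc (n + 1)) = 0 →
      HasTangentiallyRegularHessianAt (homogeneousExtension φ) (p : Euc (n + 1)) := by
  refine forall_congr' fun p => ?_
  rw [mfderiv_eq_zero_iff]
  refine imp_congr_right fun hcrit => ?_
  constructor
  · rintro ⟨ψ, hψ, hp, -, hu⟩
    exact (hasRegularHessianAt_comp_symm_iff hψ φ hp hcrit).1 ((isUnit_hessian_iff _ _).1 hu)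
  · intro hreg
    have hψ := IsManifold.chart_mem_maximalAtlas (I := 𝓡 n) (n := ∞) p
    have hp := mem_chart_source (Euc n) p
    exact ⟨_, hψ, hp, (fderiv_comp_symm_eq_zero_iff hψ φ hp).2 hcrit,
      (isUnit_hessian_iff _ _).2 ((hasRegularHessianAt_comp_symm_iff hψ φ hp hcrit).2 hreg)⟩

end Sphere

section Open

variable {n : ℕ}

/-- The space of pairs of a first and a second derivative of a real function on `ℝ^n`, as
multilinear forms; the second need not be symmetric. -/
abbrev Jet (n : ℕ) : Type :=
  ContinuousMultilinearMap ℝ (fun _ : Fin 1 => Euc n) ℝ ×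
    ContinuousMultilinearMap ℝ (fun _ : Fin 2 => Euc n) ℝ

/-- The jets that do not come from a degenerate critical point. -/
def nondegenerateJets (n : ℕ) : Set (Jet n) :=
  {j | j.1 ≠ 0 ∨ (Matrix.of fun a b : Fin n =>
    j.2 ![EuclideanSpace.single a 1, EuclideanSpace.single b 1]).det ≠ 0}

theorem isOpen_nondegenerateJets (n : ℕ) : IsOpen (nondegenerateJets n) := by
  refine (isOpen_ne.preimage continuous_fst).union (isOpen_ne.preimage ?_)
  refine (continuous_matrix fun a b => ?_).matrix_det
  exact (ContinuousMultilinearMap.apply ℝ (fun _ : Fin 2 => Euc n) ℝ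
    ![EuclideanSpace.single a 1, EuclideanSpace.single b 1]).continuous.comp continuous_snd

/-- The first and second derivatives at `x` of a function on the sphere, read in the chart `ψ`;
in the form in which `strongNhd` controls them. -/
def chartJet (ψ : OpenPartialHomeomorph (Sph n) (Euc n)) (f : Sph n → ℝ) (x : Sph n) :
    Jet n :=
  (iteratedFDeriv ℝ 1 (f ∘ ψ.symm) (ψ x), iteratedFDeriv ℝ 2 (f ∘ ψ.symm) (ψ x))

variable {ψ : OpenPartialHomeomorph (Sph n) (Euc n)} {x : Sph n}

theorem chartJet_mem_nondegenerateJets_iff (f : Sph n → ℝ) :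
    chartJet ψ f x ∈ nondegenerateJets n ↔
      (fderiv ℝ (f ∘ ψ.symm) (ψ x) = 0 → HasRegularHessianAt (f ∘ ψ.symm) (ψ x)) := by
  have hfirst : iteratedFDeriv ℝ 1 (f ∘ ψ.symm) (ψ x) = 0 ↔ fderiv ℝ (f ∘ ψ.symm) (ψ x) = 0 := by
    rw [← norm_eq_zero, norm_iteratedFDeriv_one, norm_eq_zero]
  have hsecond : (Matrix.of fun a b : Fin n => iteratedFDeriv ℝ 2 (f ∘ ψ.symm) (ψ x)
      ![EuclideanSpace.single a 1, EuclideanSpace.single b 1]) =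
        hessian (f ∘ ψ.symm) (ψ x) := by
    ext a b
    simp [hessian, iteratedFDeriv_two_apply]
  rw [nondegenerateJets, chartJet, mem_ofPred_eq, hsecond, ← isUnit_iff_ne_zero,
    ← Matrix.isUnit_iff_isUnit_det, isUnit_hessian_iff, ne_eq, hfirst, or_iff_not_imp_left, not_not]

theorem chartJet_mem_nondegenerateJets_iff_homogeneousExtension
    (hψ : ψ ∈ IsManifold.maximalAtlas (𝓡 n) ∞ (Sph n)) (φ : C^∞⟮𝓡 n, Sph n; ℝ⟯)
    (hx : x ∈ ψ.source) :
    chartJet ψ φ x ∈ nondegenerateJets n ↔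
      (fderiv ℝ (homogeneousExtension φ) (x : Euc (n + 1)) = 0 →
        HasTangentiallyRegularHessianAt (homogeneousExtension φ) (x : Euc (n + 1))) := by
  rw [chartJet_mem_nondegenerateJets_iff, fderiv_comp_symm_eq_zero_iff hψ φ hx]
  exact imp_congr_right fun hcrit => hasRegularHessianAt_comp_symm_iff hψ φ hx hcrit

theorem continuousAt_iteratedFDeriv_chart {E : Type*} [NormedAddCommGroup E] [NormedSpace ℝ E]
    {h : Euc n → E} (hh : ContDiffAt ℝ ∞ h (ψ x)) (k : ℕ) (hx : x ∈ ψ.source) :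
    ContinuousAt (fun x => iteratedFDeriv ℝ k h (ψ x)) x :=
  (hh.iteratedFDeriv_right (m := 0) (i := k)
    (by rw [zero_add]; exact WithTop.coe_le_coe.2 le_top)).continuousAt.comp (ψ.continuousAt hx)

theorem continuousAt_iteratedFDeriv_comp_symm
    (hψ : ψ ∈ IsManifold.maximalAtlas (𝓡 n) ∞ (Sph n)) (φ : C^∞⟮𝓡 n, Sph n; ℝ⟯) (k : ℕ)
    (hx : x ∈ ψ.source) : ContinuousAt (fun x => iteratedFDeriv ℝ k (φ ∘ ψ.symm) (ψ x)) x :=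
  continuousAt_iteratedFDeriv_chart (contDiffAt_comp_symm hψ φ (ψ.map_source hx)) k hx

theorem exists_forall_chartJet_mem_of_norm_sub_lt
    (hψ : ψ ∈ IsManifold.maximalAtlas (𝓡 n) ∞ (Sph n)) {U : Set (Jet n)} (hU : IsOpen U)
    {φ : C^∞⟮𝓡 n, Sph n; ℝ⟯} {K : Set (Sph n)} (hK : IsCompact K) (hKψ : K ⊆ ψ.source)
    (hφ : ∀ x ∈ K, chartJet ψ φ x ∈ U) :
    ∃ ε > 0, ∀ g : C^∞⟮𝓡 n, Sph n; ℝ⟯, (∀ x ∈ K, ∀ k ≤ 2,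
      ‖iteratedFDeriv ℝ k (g ∘ ψ.symm) (ψ x) - iteratedFDeriv ℝ k (φ ∘ ψ.symm) (ψ x)‖ < ε) →
        ∀ x ∈ K, chartJet ψ g x ∈ U := by
  have hcont : ContinuousOn (chartJet ψ φ) K := fun x hx =>
    ((continuousAt_iteratedFDeriv_comp_symm hψ φ 1 (hKψ hx)).prodMk
      (continuousAt_iteratedFDeriv_comp_symm hψ φ 2 (hKψ hx))).continuousWithinAt
  obtain ⟨ε, hε, hsub⟩ := (hK.image_of_continuousOn hcont).exists_thickening_subset_open hU
    (image_subset_iff.2 hφ)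
  refine ⟨ε, hε, fun g hg x hx => hsub (Metric.mem_thickening_iff.2 ⟨_, mem_image_of_mem _ hx, ?_⟩)⟩
  rw [Prod.dist_eq, dist_eq_norm, dist_eq_norm]
  exact max_lt (hg x hx 1 one_le_two) (hg x hx 2 le_rfl)

theorem isOpen_isMorse (n : ℕ) :
    IsOpen[whitneyTopology n (Sph n)] {φ : C^∞⟮𝓡 n, Sph n; ℝ⟯ | IsMorse φ} := by
  let _ := whitneyTopology n (Sph n)
  rw [isOpen_iff_forall_mem_open]
  intro φ hφ
  have hψ := fun p : Sph n => IsManifold.chart_mem_maximalAtlas (I := 𝓡 n) (n := ∞) p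
  choose K hKc hKp hKs using fun p : Sph n =>
    exists_compact_subset (chartAt (Euc n) p).open_source (mem_chart_source (Euc n) p)
  choose ε hε hεg using fun p => exists_forall_chartJet_mem_of_norm_sub_lt (hψ p)
    (isOpen_nondegenerateJets n) (hKc p) (hKs p) fun x hx =>
      (chartJet_mem_nondegenerateJets_iff_homogeneousExtension (hψ p) φ (hKs p hx)).2
        ((isMorse_iff φ).1 hφ x)
  obtain ⟨t, ht⟩ := CompactSpace.elim_nhds_subcover K fun p => mem_interior_iff_mem_nhds.1 (hKp p)
  refine ⟨strongNhd φ 2 (fun i : t => chartAt (Euc n) (i : Sph n)) (fun i => K i) (fun i => ε i),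
    fun g hg => (isMorse_iff g).2 fun x => ?_, ?_, ?_⟩
  · obtain ⟨p, hp, hx⟩ := mem_iUnion₂.1 (ht.symm ▸ mem_univ x : x ∈ ⋃ p ∈ t, K p)
    exact (chartJet_mem_nondegenerateJets_iff_homogeneousExtension (hψ p) g (hKs p hx)).1
      (hεg p g (hg ⟨p, hp⟩) x hx)
  · exact TopologicalSpace.isOpen_generateFrom_of_mem ⟨φ, 2, t, _, _, _, fun i => hψ i,
      locallyFinite_of_finite _, fun i => ⟨hKc i, hKs i⟩, fun i => hε i, rfl⟩
  · intro i x _ k _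
    simpa using hε i

end Open

section Dense

variable {n : ℕ}

/-- The perturbation of `φ` by the restriction to the sphere of the linear function `⟨a, ·⟩`. -/
def linearPerturbation (φ : C^∞⟮𝓡 n, Sph n; ℝ⟯) (a : Euc (n + 1)) : C^∞⟮𝓡 n, Sph n; ℝ⟯ :=
  ⟨fun x => φ x + innerSL ℝ a (x : Euc (n + 1)), by
    have := Fact.mk (@finrank_euclideanSpace_fin ℝ _ (n + 1))
    exact φ.contMDiff.add ((innerSL ℝ a).contMDiff.comp contMDiff_coe_sphere)⟩

section Chart

variable {ψ : OpenPartialHomeomorph (Sph n) (Euc n)} {x : Sph n}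

theorem iteratedFDeriv_linearPerturbation_comp_symm
    (hψ : ψ ∈ IsManifold.maximalAtlas (𝓡 n) ∞ (Sph n)) (φ : C^∞⟮𝓡 n, Sph n; ℝ⟯)
    (a : Euc (n + 1)) (k : ℕ) (hx : x ∈ ψ.source) :
    iteratedFDeriv ℝ k (linearPerturbation φ a ∘ ψ.symm) (ψ x) =
      iteratedFDeriv ℝ k (φ ∘ ψ.symm) (ψ x) +
        ContinuousLinearMap.compContinuousMultilinearMapL ℝ (fun _ : Fin k => Euc n)
          (Euc (n + 1)) ℝ (innerSL ℝ a)
          (iteratedFDeriv ℝ k (fun y => (ψ.symm y : Euc (n + 1))) (ψ x)) := by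
  have hk : (k : WithTop ℕ∞) ≤ ((⊤ : ℕ∞) : WithTop ℕ∞) := WithTop.coe_le_coe.2 le_top
  have hφ := (contDiffAt_comp_symm hψ φ (ψ.map_source hx)).of_le hk
  have hcoe := (contDiffAt_coe_symm hψ (ψ.map_source hx)).of_le hk
  rw [ContinuousLinearMap.compContinuousMultilinearMapL_apply,
    ← (innerSL ℝ a).iteratedFDeriv_comp_left hcoe le_rfl,
    ← iteratedFDeriv_add_apply hφ ((innerSL ℝ a).contDiff.contDiffAt.comp _ hcoe)]
  rfl

theorem continuousAt_iteratedFDeriv_linearPerturbation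
    (hψ : ψ ∈ IsManifold.maximalAtlas (𝓡 n) ∞ (Sph n)) (φ : C^∞⟮𝓡 n, Sph n; ℝ⟯)
    (a : Euc (n + 1)) (k : ℕ) (hx : x ∈ ψ.source) :
    ContinuousAt (fun z : Euc (n + 1) × Sph n =>
      iteratedFDeriv ℝ k (linearPerturbation φ z.1 ∘ ψ.symm) (ψ z.2)) (a, x) := by
  have hφ := continuousAt_iteratedFDeriv_comp_symm hψ φ k hx
  have hcoe := continuousAt_iteratedFDeriv_chart
    (contDiffAt_coe_symm hψ (ψ.map_source hx)) k hx
  have hinner : ContinuousAt (fun z : Euc (n + 1) × Sph n =>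
      ContinuousLinearMap.compContinuousMultilinearMapL ℝ (fun _ : Fin k => Euc n)
        (Euc (n + 1)) ℝ (innerSL ℝ z.1)) (a, x) :=
    ((ContinuousLinearMap.compContinuousMultilinearMapL ℝ (fun _ : Fin k => Euc n)
      (Euc (n + 1)) ℝ).continuous.comp ((innerSL ℝ).continuous.comp continuous_fst)).continuousAt
  refine ((hφ.comp_of_eq (f := Prod.snd) continuousAt_snd rfl).add (hinner.clm_apply
    (hcoe.comp_of_eq (f := Prod.snd) continuousAt_snd rfl))).congr ?_
  filter_upwards [continuousAt_snd.eventually (ψ.open_source.mem_nhds hx)] with z hz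
  exact (iteratedFDeriv_linearPerturbation_comp_symm hψ φ z.1 k hz).symm

theorem eventually_forall_norm_iteratedFDeriv_linearPerturbation_sub_lt
    (hψ : ψ ∈ IsManifold.maximalAtlas (𝓡 n) ∞ (Sph n)) {φ f : C^∞⟮𝓡 n, Sph n; ℝ⟯} {k : ℕ}
    {K : Set (Sph n)} (hK : IsCompact K) (hKψ : K ⊆ ψ.source) {ε : ℝ} {a₀ : Euc (n + 1)}
    (hlt : ∀ x ∈ K, ‖iteratedFDeriv ℝ k (linearPerturbation φ a₀ ∘ ψ.symm) (ψ x) -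
      iteratedFDeriv ℝ k (f ∘ ψ.symm) (ψ x)‖ < ε) :
    ∀ᶠ a in 𝓝 a₀, ∀ x ∈ K, ‖iteratedFDeriv ℝ k (linearPerturbation φ a ∘ ψ.symm) (ψ x) -
      iteratedFDeriv ℝ k (f ∘ ψ.symm) (ψ x)‖ < ε := by
  refine hK.eventually_forall_of_forall_eventually fun x hx => ?_
  have hf := continuousAt_iteratedFDeriv_comp_symm hψ f k (hKψ hx)
  exact ((continuousAt_iteratedFDeriv_linearPerturbation hψ φ a₀ k (hKψ hx)).sub
    (hf.comp_of_eq (f := Prod.snd) continuousAt_snd rfl)).norm.eventually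
      (gt_mem_nhds (hlt x hx))

end Chart

theorem linearPerturbation_zero (φ : C^∞⟮𝓡 n, Sph n; ℝ⟯) : linearPerturbation φ 0 = φ := by
  ext x
  change φ x + innerSL ℝ 0 (x : Euc (n + 1)) = φ x
  simp

theorem tendsto_linearPerturbation (φ : C^∞⟮𝓡 n, Sph n; ℝ⟯) :
    Tendsto (linearPerturbation φ) (𝓝 0) (@nhds _ (whitneyTopology n (Sph n)) φ) := by
  rw [TopologicalSpace.tendsto_nhds_generateFrom_iff]
  rintro _ ⟨f, r, ι, ψ, K, ε, hψ, hfin, hK, -, rfl⟩ hφ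
  rw [← linearPerturbation_zero φ] at hφ
  have hclose : ∀ᶠ a in 𝓝 (0 : Euc (n + 1)), ∀ i ∈ {i | (ψ i).source.Nonempty}, ∀ k ∈ Iic r,
      ∀ x ∈ K i, ‖iteratedFDeriv ℝ k (linearPerturbation φ a ∘ (ψ i).symm) (ψ i x) -
        iteratedFDeriv ℝ k (f ∘ (ψ i).symm) (ψ i x)‖ < ε i :=
    (eventually_all_finite hfin.finite_nonempty_of_compact).2 fun i _ =>
      (eventually_all_finite (finite_Iic r)).2 fun k hk =>
        eventually_forall_norm_iteratedFDeriv_linearPerturbation_sub_lt (hψ i) (hK i).1 (hK i).2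
          fun x hx => hφ i x hx k hk
  filter_upwards [hclose] with a ha i x hx k hk
  exact ha i ⟨x, (hK i).2 hx⟩ k hk x hx

end Dense

theorem IsSmoothZeroHomogeneous.smul_fderiv_smul {d : ℕ} {Φ : Euc d → ℝ}
    (hΦ : IsSmoothZeroHomogeneous Φ) {r : ℝ} (hr : 0 < r) {ξ : Euc d} (hξ : ξ ≠ 0) :
    r • fderiv ℝ Φ (r • ξ) = fderiv ℝ Φ ξ := by
  have heq : (fun η => Φ (r • η)) =ᶠ[𝓝 ξ] Φ := by
    filter_upwards [isOpen_compl_singleton.mem_nhds hξ] with η hη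
    exact hΦ.homogeneous r hr η hη
  rw [← heq.fderiv_eq, fderiv_comp_smul]

section InnerProductSpace

variable {E : Type*} [NormedAddCommGroup E] [InnerProductSpace ℝ E]

theorem one_add_inner_pos {a q : E} (ha : ‖a‖ < 1) (hq : ‖q‖ = 1) : 0 < 1 + inner ℝ a q := by
  have := abs_real_inner_le_norm a q
  rw [hq, mul_one] at this
  linarith [neg_abs_le (inner ℝ a q)]

theorem apply_eq_of_hasFDerivAt_of_eqOn_sphere {G : Type*} [NormedAddCommGroup G] [NormedSpace ℝ G]
    {f g : E → G} {f' g' : E →L[ℝ] G} {p z : E} (hp : ‖p‖ = 1) (hf : HasFDerivAt f f' p)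
    (hg : HasFDerivAt g g' p) (hfg : EqOn f g (Metric.sphere 0 1)) (hz : inner ℝ p z = 0) :
    f' z = g' z := by
  have hp₀ : p ≠ 0 := ne_zero_of_norm_ne_zero (by simp [hp])
  have hp₁ : ‖p‖⁻¹ • p = p := by simp [hp]
  let normalize : E → E := fun ξ => ‖ξ‖⁻¹ • ξ
  have heq : f ∘ normalize =ᶠ[𝓝 p] g ∘ normalize := by
    filter_upwards [isOpen_compl_singleton.mem_nhds hp₀] with ξ hξ
    exact hfg (mem_sphere_zero_iff_norm.2 (norm_smul_inv_norm (𝕜 := ℝ) hξ))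
  rw [← hp₁] at hf hg
  have hunique := (hf.comp (f := normalize) p (hasFDerivAt_normalize hp₀)).unique
    ((hg.comp (f := normalize) p (hasFDerivAt_normalize hp₀)).congr_of_eventuallyEq heq)
  simpa [hp, hz] using congrArg (fun L => L z) hunique

end InnerProductSpace

section Sard

variable {d : ℕ}

/-- The map whose critical values of norm less than `1` contain every `a` for which the linear
perturbation by `a` of the restriction of `F` to the sphere is not Morse. -/
def sardMap (F : Euc d → ℝ) (ξ : Euc d) : Euc d :=
  ξ - ‖ξ‖⁻¹ • ξ - ‖ξ‖ • gradient F ξ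

variable {F : Euc d → ℝ} {ξ : Euc d}

theorem IsSmoothZeroHomogeneous.hasFDerivAt_gradient (hF : IsSmoothZeroHomogeneous F)
    (hξ : ξ ≠ 0) : HasFDerivAt (gradient F)
      ((InnerProductSpace.toDual ℝ (Euc d)).symm.toContinuousLinearEquiv.toContinuousLinearMap.comp
        (fderiv ℝ (fderiv ℝ F) ξ)) ξ :=
  (InnerProductSpace.toDual ℝ (Euc d)).symm.toContinuousLinearEquiv.hasFDerivAt.comp ξ
    ((hF.contDiffAt_fderiv hξ).differentiableAt (by simp)).hasFDerivAt

theorem IsSmoothZeroHomogeneous.differentiableAt_sardMap (hF : IsSmoothZeroHomogeneous F)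
    (hξ : ξ ≠ 0) : DifferentiableAt ℝ (sardMap F) ξ :=
  (differentiableAt_id.sub (hasFDerivAt_normalize hξ).differentiableAt).sub
    ((hasFDerivAt_norm hξ).differentiableAt.smul (hF.hasFDerivAt_gradient hξ).differentiableAt)

end Sard

section MorsePerturbation

variable {n : ℕ}

theorem homogeneousExtension_linearPerturbation (φ : C^∞⟮𝓡 n, Sph n; ℝ⟯) (a : Euc (n + 1))
    {ξ : Euc (n + 1)} (hξ : ξ ≠ 0) :
    homogeneousExtension (linearPerturbation φ a) ξ =
      homogeneousExtension φ ξ + innerSL ℝ a (‖ξ‖⁻¹ • ξ) := by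
  rw [homogeneousExtension_eq _ hξ, homogeneousExtension_eq _ hξ, ← coe_radial hξ]
  rfl

variable {q : Euc (n + 1)}

theorem gradient_homogeneousExtension_linearPerturbation (φ : C^∞⟮𝓡 n, Sph n; ℝ⟯)
    (a : Euc (n + 1)) (hq : ‖q‖ = 1) :
    gradient (homogeneousExtension (linearPerturbation φ a)) q =
      gradient (homogeneousExtension φ) q + (a - inner ℝ a q • q) := by
  have hq₀ : q ≠ 0 := ne_zero_of_norm_ne_zero (by simp [hq])
  have hF := (((isSmoothZeroHomogeneous_homogeneousExtension φ).contDiffAt hq₀).differentiableAt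
    (by simp)).hasFDerivAt
  have hsum := (hF.add ((innerSL ℝ a).hasFDerivAt.comp q
    (hasFDerivAt_normalize hq₀))).congr_of_eventuallyEq
      (f₁ := homogeneousExtension (linearPerturbation φ a)) (by
        filter_upwards [isOpen_compl_singleton.mem_nhds hq₀] with ξ hξ
        exact homogeneousExtension_linearPerturbation φ a hξ)
  rw [gradient, gradient, hsum.fderiv, map_add]
  congr 1
  apply (InnerProductSpace.toDual ℝ (Euc (n + 1))).injective
  rw [LinearIsometryEquiv.apply_symm_apply]
  ext z
  simp [hq]
  ring

theorem sardMap_smul_eq (φ : C^∞⟮𝓡 n, Sph n; ℝ⟯) {a : Euc (n + 1)} (hq : ‖q‖ = 1)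
    (hpos : 0 < 1 + inner ℝ a q) :
    sardMap (homogeneousExtension φ) ((1 + inner ℝ a q) • q) =
      a - gradient (homogeneousExtension (linearPerturbation φ a)) q := by
  have hq₀ : q ≠ 0 := ne_zero_of_norm_ne_zero (by simp [hq])
  have hnorm : ‖(1 + inner ℝ a q) • q‖ = 1 + inner ℝ a q := by
    rw [norm_smul, hq, mul_one, Real.norm_of_nonneg hpos.le]
  have hgradient : (1 + inner ℝ a q) • gradient (homogeneousExtension φ) ((1 + inner ℝ a q) • q) =
      gradient (homogeneousExtension φ) q := by
    rw [gradient, gradient,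
      ← (isSmoothZeroHomogeneous_homogeneousExtension φ).smul_fderiv_smul hpos hq₀, map_smul]
  rw [sardMap, hnorm, hgradient, gradient_homogeneousExtension_linearPerturbation φ a hq, smul_smul,
    inv_mul_cancel₀ hpos.ne', one_smul]
  module

variable {p : Sph n} {φ : C^∞⟮𝓡 n, Sph n; ℝ⟯} {a z : Euc (n + 1)}

theorem fderiv_sardMap_apply_eq_zero (ha : ‖a‖ < 1) (hz : inner ℝ (p : Euc (n + 1)) z = 0)
    (hDz : fderiv ℝ (fderiv ℝ (homogeneousExtension (linearPerturbation φ a)))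
      (p : Euc (n + 1)) z = 0) :
    fderiv ℝ (sardMap (homogeneousExtension φ))
      ((1 + inner ℝ a (p : Euc (n + 1))) • (p : Euc (n + 1)))
      ((1 + inner ℝ a (p : Euc (n + 1))) • z + inner ℝ a z • (p : Euc (n + 1))) = 0 := by
  have hp := coe_sphere_ne_zero p
  have hpos := one_add_inner_pos ha (norm_eq_of_mem_sphere p)
  have hscale : HasFDerivAt (fun q : Euc (n + 1) => (1 + inner ℝ a q) • q)
      ((1 + inner ℝ a (p : Euc (n + 1))) • ContinuousLinearMap.id ℝ (Euc (n + 1)) +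
        (innerSL ℝ a).smulRight (p : Euc (n + 1))) (p : Euc (n + 1)) :=
    ((innerSL ℝ a).hasFDerivAt.const_add 1).smul (hasFDerivAt_id (p : Euc (n + 1)))
  have hsard := ((isSmoothZeroHomogeneous_homogeneousExtension φ).differentiableAt_sardMap
    (smul_ne_zero hpos.ne' hp)).hasFDerivAt.comp (f := fun q => (1 + inner ℝ a q) • q)
      (p : Euc (n + 1)) hscale
  have hgradient := ((isSmoothZeroHomogeneous_homogeneousExtension
    (linearPerturbation φ a)).hasFDerivAt_gradient hp).const_sub a
  simpa [hDz] using apply_eq_of_hasFDerivAt_of_eqOn_sphere (norm_eq_of_mem_sphere p) hsard hgradient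
    (fun q hq => sardMap_smul_eq φ (mem_sphere_zero_iff_norm.1 hq)
      (one_add_inner_pos ha (mem_sphere_zero_iff_norm.1 hq))) hz

theorem mem_image_sardMap_of_not_isMorse (ha : ‖a‖ < 1)
    (hnot : ¬ IsMorse (linearPerturbation φ a)) :
    a ∈ sardMap (homogeneousExtension φ) '' {ξ | ξ ≠ 0 ∧
      (fderiv ℝ (sardMap (homogeneousExtension φ)) ξ).det = 0} := by
  rw [isMorse_iff] at hnot
  push Not at hnot
  obtain ⟨p, hcrit, hreg⟩ := hnot
  simp only [HasTangentiallyRegularHessianAt, not_forall] at hreg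
  obtain ⟨z, hz, hDz, hz₀⟩ := hreg
  have hp := norm_eq_of_mem_sphere p
  have hpos := one_add_inner_pos ha hp
  refine ⟨(1 + inner ℝ a (p : Euc (n + 1))) • (p : Euc (n + 1)),
    ⟨smul_ne_zero hpos.ne' (coe_sphere_ne_zero p), ?_⟩, ?_⟩
  · refine LinearMap.det_eq_zero_iff_ker_ne_bot.2 fun hker => ?_
    have hmem := LinearMap.mem_ker.2 (fderiv_sardMap_apply_eq_zero ha hz hDz)
    rw [hker, Submodule.mem_bot] at hmem
    have hinner := congrArg (fun v => inner ℝ z v) hmem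
    simp only [inner_add_right, inner_smul_right, real_inner_comm (p : Euc (n + 1)) z, hz,
      mul_zero, add_zero, inner_zero_right, mul_eq_zero, hpos.ne', false_or] at hinner
    exact hz₀ (inner_self_eq_zero.1 hinner)
  · rw [sardMap_smul_eq φ hp hpos, gradient, hcrit, map_zero, sub_zero]

theorem frequently_isMorse_linearPerturbation (φ : C^∞⟮𝓡 n, Sph n; ℝ⟯) :
    ∃ᶠ a in 𝓝 0, IsMorse (linearPerturbation φ a) := by
  intro hcon
  have hF := isSmoothZeroHomogeneous_homogeneousExtension φ
  have hnull := addHaar_image_eq_zero_of_det_fderivWithin_eq_zero (s := {ξ | ξ ≠ 0 ∧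
      (fderiv ℝ (sardMap (homogeneousExtension φ)) ξ).det = 0}) volume
    (fun ξ hξ => (hF.differentiableAt_sardMap hξ.1).hasFDerivAt.hasFDerivWithinAt)
    fun ξ hξ => hξ.2
  have hmem : sardMap (homogeneousExtension φ) '' {ξ | ξ ≠ 0 ∧
      (fderiv ℝ (sardMap (homogeneousExtension φ)) ξ).det = 0} ∈ 𝓝 (0 : Euc (n + 1)) := by
    filter_upwards [hcon, Metric.ball_mem_nhds (0 : Euc (n + 1)) one_pos] with a ha hball
    exact mem_image_sardMap_of_not_isMorse (mem_ball_zero_iff.1 hball) ha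
  exact (Measure.measure_pos_of_mem_nhds volume hmem).ne' hnull

theorem dense_isMorse (n : ℕ) :
    @Dense _ (whitneyTopology n (Sph n)) {φ : C^∞⟮𝓡 n, Sph n; ℝ⟯ | IsMorse φ} := by
  let _ := whitneyTopology n (Sph n)
  exact fun φ => mem_closure_of_frequently_of_tendsto (frequently_isMorse_linearPerturbation φ)
    (tendsto_linearPerturbation φ)

theorem exists_hasRegularHessianAt_of_isMorse (hn : n ≠ 0) (hφ : IsMorse φ) :
    ∃ ξ : Euc (n + 1), ξ ≠ 0 ∧ HasRegularHessianAt (homogeneousExtension φ) ξ := by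
  obtain ⟨p, -, hmax⟩ := isCompact_univ.exists_isMaxOn univ_nonempty
    φ.contMDiff.continuous.continuousOn
  have hp := coe_sphere_ne_zero p
  have hcrit : fderiv ℝ (homogeneousExtension φ) (p : Euc (n + 1)) = 0 := by
    refine IsLocalMax.fderiv_eq_zero ?_
    filter_upwards [isOpen_compl_singleton.mem_nhds hp] with ξ hξ
    rw [homogeneousExtension_coe, homogeneousExtension_eq φ hξ]
    exact hmax (mem_univ _)
  exact exists_hasRegularHessianAt_of_fderiv_eq_zero
    (isSmoothZeroHomogeneous_homogeneousExtension φ) (by lia) hp hcrit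
    ((isMorse_iff φ).1 hφ p hcrit)

end MorsePerturbation

end GenericMultiplier

end

theorem theorem2_general :
    (∀ Φ : GenericMultiplier.Euc 2 → ℝ,
      GenericMultiplier.IsSmoothZeroHomogeneous Φ →
      (¬ ∃ a : ℝ, ∀ ξ : GenericMultiplier.Euc 2, ξ ≠ 0 → Φ ξ = a) →
      ∀ p : ℝ, 0 < p →
        ∃ c : ℝ, 0 < c ∧ ∀ t : ℝ,
          ENNReal.ofReal (c * GenericMultiplier.japanese t ^ (2 * |1 / 2 - 1 / p|)) ≤
            GenericMultiplier.multiplierNorm Φ t p) ∧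
    (∀ d n : ℕ, n ≠ 0 → d = n + 1 →
      ∃ 𝒢 : Set C^∞⟮𝓡 n, GenericMultiplier.Sph n; ℝ⟯,
        𝒢 = {φ | GenericMultiplier.IsMorse φ} ∧
        IsOpen[GenericMultiplier.whitneyTopology n (GenericMultiplier.Sph n)] 𝒢 ∧
        @Dense _ (GenericMultiplier.whitneyTopology n (GenericMultiplier.Sph n)) 𝒢 ∧
        ∀ φ ∈ 𝒢,
          GenericMultiplier.IsSmoothZeroHomogeneous
            (GenericMultiplier.homogeneousExtension φ) ∧
          ∀ p : ℝ, 0 < p →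
            ∃ c : ℝ, 0 < c ∧ ∀ t : ℝ,
              ENNReal.ofReal
                  (c * GenericMultiplier.japanese t ^ ((d : ℝ) * |1 / 2 - 1 / p|)) ≤
                GenericMultiplier.multiplierNorm
                  (GenericMultiplier.homogeneousExtension φ) t p) := by
  refine ⟨fun Φ hΦ hnc p hp => ?_, ?_⟩
  · obtain ⟨ξ, hξ, hDξ⟩ := hΦ.exists_fderiv_ne_zero one_lt_two hnc
    exact_mod_cast GenericMultiplier.exists_le_multiplierNorm_of_hasRegularHessianAt hΦ hξ
      (hΦ.hasRegularHessianAt_of_fderiv_ne_zero hξ hDξ) hp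
  · rintro d n hn rfl
    refine ⟨_, rfl, GenericMultiplier.isOpen_isMorse n, GenericMultiplier.dense_isMorse n,
      fun φ hφ => ?_⟩
    have hF := GenericMultiplier.isSmoothZeroHomogeneous_homogeneousExtension φ
    obtain ⟨ξ, hξ, hreg⟩ := GenericMultiplier.exists_hasRegularHessianAt_of_isMorse hn hφ
    exact ⟨hF, fun p hp =>
      GenericMultiplier.exists_le_multiplierNorm_of_hasRegularHessianAt hF hξ hreg hp⟩

theorem theorem2 :
    (∀ Φ : GenericMultiplier.Euc 2 → ℝ,
      GenericMultiplier.IsSmoothZeroHomogeneous Φ →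
      (¬ ∃ a : ℝ, ∀ ξ : GenericMultiplier.Euc 2, ξ ≠ 0 → Φ ξ = a) →
      ∀ p : ℝ, 1 < p →
        ∃ c : ℝ, 0 < c ∧ ∀ t : ℝ,
          ENNReal.ofReal (c * GenericMultiplier.japanese t ^ (2 * |1 / 2 - 1 / p|)) ≤
            GenericMultiplier.multiplierNorm Φ t p) ∧
    (∀ d n : ℕ, 3 ≤ d → d = n + 1 →
      ∃ 𝒢 : Set C^∞⟮𝓡 n, GenericMultiplier.Sph n; ℝ⟯,
        𝒢 = {φ | GenericMultiplier.IsMorse φ} ∧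
        IsOpen[GenericMultiplier.whitneyTopology n (GenericMultiplier.Sph n)] 𝒢 ∧
        @Dense _ (GenericMultiplier.whitneyTopology n (GenericMultiplier.Sph n)) 𝒢 ∧
        ∀ φ ∈ 𝒢,
          GenericMultiplier.IsSmoothZeroHomogeneous
            (GenericMultiplier.homogeneousExtension φ) ∧
          ∀ p : ℝ, 1 < p →
            ∃ c : ℝ, 0 < c ∧ ∀ t : ℝ,
              ENNReal.ofReal
                  (c * GenericMultiplier.japanese t ^ ((d : ℝ) * |1 / 2 - 1 / p|)) ≤
                GenericMultiplier.multiplierNorm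
                  (GenericMultiplier.homogeneousExtension φ) t p) := by
  refine ⟨fun Φ hΦ hnc p hp => theorem2_general.1 Φ hΦ hnc p (one_pos.trans hp),
    fun d n hd hdn => ?_⟩
  obtain ⟨𝒢, h𝒢, hopen, hdense, hbound⟩ := theorem2_general.2 d n (by lia) hdn
  exact ⟨𝒢, h𝒢, hopen, hdense, fun φ hφ => (hbound φ hφ).imp_right fun h p hp =>
    h p (one_pos.trans hp)⟩
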